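/- Let $m, n, p$ be integers with $m \ge 0$ and $0\le p<n$. A transfer function matrix (TFM) is a matrix with entries in $\mathbb{R}(\lambda)$; it is proper if no entry has a pole at infinity. Its McMillan degree is the sum of the degrees of its finite and infinite poles, where the finite poles are read off the denominators of its Smith–McMillan form and the poles of $\mathbf G(\lambda)$ at infinity are those of $\mathbf G(1/\lambda)$ at $\lambda=0$. A realization of order $\nu$ of a TFM $\mathbf G$ consists of real matrices $A\in\mathbb{R}^{\nu\times\nu}$, $B$, $C$, $D$ with $\mathbf G(\lambda)=D+C(\lambda I_\nu-A)^{-1}B$; it is minimal if no realization of $\mathbf G$ has a smaller order. Consider the realization of order $n$ $$A=\begin{bmatrix}A_{11}&A_{12}\\A_{21}&A_{22}\end{bmatrix},\qquad B=\begin{bmatrix}B_1\\B_2\end{bmatrix},\qquad C=\begin{bmatrix}I_p&O\end{bmatrix},\qquad D=O,$$ with real blocks $A_{11}\in\mathbb{R}^{p\times p}$, $A_{12}\in\mathbb{R}^{p\times(n-p)}$, $A_{21}\in\mathbb{R}^{(n-p)\times p}$, $A_{22}\in\mathbb{R}^{(n-p)\times(n-p)}$, $B_1\in\mathbb{R}^{p\times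 m}$, $B_2\in\mathbb{R}^{(n-p)\times m}$. Assume that $(C,A)$ is observable, i.e. $\begin{bmatrix}A^\top-\lambda I_n & C^\top\end{bmatrix}$ has full row rank for every $\lambda\in\mathbb{C}$, and let $\mathbf G(\lambda)=C(\lambda I_n-A)^{-1}B$. An SRTR pair of this system is a pair $(\mathbf W,\mathbf V)$ of proper TFMs, of sizes $p\times p$ and $p\times m$, such that $\begin{bmatrix}\mathbf W&\mathbf V\end{bmatrix}$ has McMillan degree at most $n-p$, $\lambda I_p-\mathbf W(\lambda)$ is invertible over $\mathbb{R}(\lambda)$, and $\mathbf G(\lambda)=(\lambda I_p-\mathbf W(\lambda))^{-1}\mathbf V(\lambda)$. For $K\in\mathbb{R}^{(n-p)\times p}$ consider the formula $$\begin{bmatrix}\mathbf W(\lambda)&\mathbf V(\lambda)\end{bmatrix}=\begin{bmatrix}A_{11}-A_{12}K&B_1\end{bmatrix}+A_{12}\big(\lambda I_{n-p}-A_{22}-KA_{12}\big)^{-1}\begin{bmatrix}KA_{11}-KA_{12}K+A_{21}-A_{22}K&KB_1+B_2\end{bmatrix}.\qquad(\ast)$$ Then: a) for every $K\in\mathbb{R}^{(n-p)\times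 p}$, the pair $(\mathbf W,\mathbf V)$ given by $(\ast)$ is an SRTR pair of the system; b) every SRTR pair of the system is given by $(\ast)$ for some $K\in\mathbb{R}^{(n-p)\times p}$ if and only if the above realization of order $n$ is minimal. -/

import Mathlib

open Matrix Polynomial

noncomputable section

namespace SRTR

/-- A transfer function matrix (TFM): a matrix of real rational functions of `λ`; the indeterminate
`λ` is `RatFunc.X`. -/
abbrev TFM (p m : Type*) := Matrix p m (RatFunc ℝ)

/-! ### State-space realizations -/

/-- A state-space system `σx = Ax + Bu`, `y = Cx + Du` with states indexed by `n`, inputs by `m`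
and outputs by `p`. -/
structure StateSpace (n m p : Type*) where
  /-- state matrix -/
  A : Matrix n n ℝ
  /-- input matrix -/
  B : Matrix n m ℝ
  /-- output matrix -/
  C : Matrix p n ℝ
  /-- feedthrough matrix -/
  D : Matrix p m ℝ

section Realizations

variable {n m p : Type*} [Fintype n] [DecidableEq n]

/-- `D + C (λI - A)⁻¹ B`.  The matrix `λI - A` is invertible over `ℝ(λ)`, because its determinant
is the characteristic polynomial of `A`. -/
def StateSpace.tfm (S : StateSpace n m p) : TFM p m :=
  S.D.map RatFunc.C +
    S.C.map RatFunc.C * ((RatFunc.X : RatFunc ℝ) • (1 : TFM n n) - S.A.map RatFunc.C)⁻¹ * S.B.map RatFunc.C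

/-- The pair `(A, B)` is controllable at the complex number `z`: the matrix `[A - zI  B]` has full
row rank. -/
def ControllableAt [Fintype m] (A : Matrix n n ℝ) (B : Matrix n m ℝ) (z : ℂ) : Prop :=
  (Matrix.fromCols (A.map Complex.ofReal - z • (1 : Matrix n n ℂ)) (B.map Complex.ofReal)).rank =
    Fintype.card n

/-- The pair `(C, A)` is observable: `(Aᵀ, Cᵀ)` is controllable at every complex number. -/
def Observable [Fintype p] (C : Matrix p n ℝ) (A : Matrix n n ℝ) : Prop :=
  ∀ z : ℂ, ControllableAt Aᵀ Cᵀ z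

/-- The order of `S` is the smallest among all the realizations of the TFM of `S`. -/
def StateSpace.IsMinimal (S : StateSpace n m p) : Prop :=
  ∀ (k : ℕ) (S' : StateSpace (Fin k) m p), S'.tfm = S.tfm → Fintype.card n ≤ k

end Realizations

/-! ### Smith-McMillan form and McMillan degree -/

/-- The `p × m` matrix with the entries `ε₁/ψ₁, …, εᵣ/ψᵣ` in the first `r` diagonal positions and
with zeros elsewhere. -/
def smithMcMillanDiagonal (p m : ℕ) {r : ℕ} (ε ψ : Fin r → ℝ[X]) : TFM (Fin p) (Fin m) :=
  Matrix.of fun i j =>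
    if h : i.val < r then
      if j.val = i.val then
        algebraMap ℝ[X] (RatFunc ℝ) (ε ⟨i.val, h⟩) / algebraMap ℝ[X] (RatFunc ℝ) (ψ ⟨i.val, h⟩)
      else 0
    else 0

/-- The Smith-McMillan form of `G` is `diag (ε₁/ψ₁, …, εᵣ/ψᵣ, 0, …)`: the polynomials are monic,
every fraction `εₖ/ψₖ` is irreducible, `εₖ` divides `εₗ` and `ψₗ` divides `ψₖ` for `k ≤ l`, and the
form is obtained from `G` by multiplication with unimodular polynomial matrices. -/
structure IsSmithMcMillanForm {p m : ℕ} (G : TFM (Fin p) (Fin m)) {r : ℕ} (ε ψ : Fin r → ℝ[X]) :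
    Prop where
  le_rows : r ≤ p
  le_cols : r ≤ m
  monic_num : ∀ k, (ε k).Monic
  monic_den : ∀ k, (ψ k).Monic
  coprime : ∀ k, IsCoprime (ε k) (ψ k)
  num_dvd : ∀ k l, k ≤ l → ε k ∣ ε l
  den_dvd : ∀ k l, k ≤ l → ψ l ∣ ψ k
  factorization : ∃ (U : Matrix (Fin p) (Fin p) ℝ[X]) (V : Matrix (Fin m) (Fin m) ℝ[X]),
    IsUnit U.det ∧ IsUnit V.det ∧
      G = U.map (algebraMap ℝ[X] (RatFunc ℝ)) * smithMcMillanDiagonal p m ε ψ *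
        V.map (algebraMap ℝ[X] (RatFunc ℝ))

/-- The TFM `G(1/λ)`. -/
def atInv {p m : Type*} (G : TFM p m) : TFM p m :=
  G.map (RatFunc.eval RatFunc.C (RatFunc.X : RatFunc ℝ)⁻¹)

/-- `d` is the sum of the degrees of the finite poles of `G`.  These are the complex roots of the
denominators `ψₖ` in the Smith-McMillan form of `G`, counted with multiplicity. -/
def HasFinitePoleDegree {p m : ℕ} (G : TFM (Fin p) (Fin m)) (d : ℕ) : Prop :=
  ∃ (r : ℕ) (ε ψ : Fin r → ℝ[X]), IsSmithMcMillanForm G ε ψ ∧ d = ∑ k, (ψ k).natDegree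

/-- `d` is the sum of the degrees of the poles of `G` at infinity, which are the poles of `G(1/λ)`
at `λ = 0`. -/
def HasInfinitePoleDegree {p m : ℕ} (G : TFM (Fin p) (Fin m)) (d : ℕ) : Prop :=
  ∃ (r : ℕ) (ε ψ : Fin r → ℝ[X]),
    IsSmithMcMillanForm (atInv G) ε ψ ∧ d = ∑ k, (ψ k).rootMultiplicity 0

/-- `δ` is the McMillan degree of `G`: the sum of the degrees of all its poles, finite and infinite.
(The Smith-McMillan form of a TFM exists and is unique, so that there is exactly one such `δ`.) -/
def HasMcMillanDegree {p m : ℕ} (G : TFM (Fin p) (Fin m)) (δ : ℕ) : Prop :=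
  ∃ d e : ℕ, HasFinitePoleDegree G d ∧ HasInfinitePoleDegree G e ∧ δ = d + e

/-- `G` is proper, i.e. no entry has a pole at infinity: in every entry the degree of the
numerator is at most the degree of the denominator. -/
def IsProper {p m : Type*} (G : TFM p m) : Prop :=
  ∀ i j, (G i j).num.natDegree ≤ (G i j).denom.natDegree

/-! ### System response-type realizations -/

/-- The block matrix `[W  V]`, with its columns numbered consecutively. -/
def hcat {p m : ℕ} (W : TFM (Fin p) (Fin p)) (V : TFM (Fin p) (Fin m)) :
    TFM (Fin p) (Fin (p + m)) :=
  (Matrix.fromCols W V).submatrix id finSumFinEquiv.symm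

/-- The realization of order `n = p + q` with the state `(y, x)`, the state matrix
`[A₁₁ A₁₂; A₂₁ A₂₂]`, the input matrix `[B₁; B₂]`, the output matrix `[I O]` and no feedthrough. -/
def network {p q m : ℕ} (A₁₁ : Matrix (Fin p) (Fin p) ℝ) (A₁₂ : Matrix (Fin p) (Fin q) ℝ)
    (A₂₁ : Matrix (Fin q) (Fin p) ℝ) (A₂₂ : Matrix (Fin q) (Fin q) ℝ)
    (B₁ : Matrix (Fin p) (Fin m) ℝ) (B₂ : Matrix (Fin q) (Fin m) ℝ) :
    StateSpace (Fin p ⊕ Fin q) (Fin m) (Fin p) where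
  A := Matrix.fromBlocks A₁₁ A₁₂ A₂₁ A₂₂
  B := Matrix.fromRows B₁ B₂
  C := Matrix.fromCols 1 0
  D := 0

/-- `(W, V)` is a system response-type realization (SRTR pair) of a realization `S` of order
`n = p + q`: `W` and `V` are proper, the McMillan degree of `[W  V]` is at most `n - p = q`, and
`G = (λI - W)⁻¹ V` for the TFM `G` of `S`. -/
structure IsSRTRPair {p q m : ℕ} (S : StateSpace (Fin p ⊕ Fin q) (Fin m) (Fin p))
    (W : TFM (Fin p) (Fin p)) (V : TFM (Fin p) (Fin m)) : Prop where
  proper_W : IsProper W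
  proper_V : IsProper V
  degree_le : ∃ δ : ℕ, HasMcMillanDegree (hcat W V) δ ∧ δ ≤ q
  isUnit_det : IsUnit ((RatFunc.X : RatFunc ℝ) • (1 : TFM (Fin p) (Fin p)) - W).det
  tfm_eq : S.tfm = ((RatFunc.X : RatFunc ℝ) • (1 : TFM (Fin p) (Fin p)) - W)⁻¹ * V

/-- The realization of order `q = n - p` that expresses `[W  V]` in terms of the matrix `K`. -/
def srtrRealization {p q m : ℕ} (A₁₁ : Matrix (Fin p) (Fin p) ℝ) (A₁₂ : Matrix (Fin p) (Fin q) ℝ)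
    (A₂₁ : Matrix (Fin q) (Fin p) ℝ) (A₂₂ : Matrix (Fin q) (Fin q) ℝ)
    (B₁ : Matrix (Fin p) (Fin m) ℝ) (B₂ : Matrix (Fin q) (Fin m) ℝ)
    (K : Matrix (Fin q) (Fin p) ℝ) : StateSpace (Fin q) (Fin p ⊕ Fin m) (Fin p) where
  A := A₂₂ + K * A₁₂
  B := Matrix.fromCols (K * A₁₁ - K * A₁₂ * K + A₂₁ - A₂₂ * K) (K * B₁ + B₂)
  C := A₁₂
  D := Matrix.fromCols (A₁₁ - A₁₂ * K) B₁

end SRTR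

end

/-! In a network with state `(y, x)`, the first block row of the state equation, after elimination
of `x`, reads `λy = Wy + Vu`, where `[W V]` is the transfer matrix of the subsystem with state `x`,
input `(y, u)` and output `σy`. Hence `(λI - W)G = V`. The block elimination also gives an explicit
right inverse of `λI - W`, and `[W V]` is realized with order `q`, so its degree is at most `q`
(`isSRTRPair_of_subsystem`). The coordinates `(y, x + Ky)` leave `G` and the form of `C` unchanged,
and the subsystem in these coordinates is exactly the realization in (∗). This is a).

The link between McMillan degree and order is the response module: polynomial inputs modulo those
with polynomial response. The Smith-McMillan form identifies it with the product of the `ℝ[λ]/(ψₖ)`,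
so its dimension is the finite pole degree, which for a proper matrix is the whole McMillan degree.
It also carries a realization of a proper matrix, and its dimension bounds the order of every
realization from below.

If the network is minimal, realize `[W V]` with some order `d ≤ q` and glue it to a network of order
`p + d` with the same `G`. Minimality forces `d = q`, and the two networks are similar through some
`T`. Since `T` preserves `C = [I 0]`, it is block lower triangular with first block row `[I 0]`, and
`K = T₂₂⁻¹T₂₁` is the required matrix (`exists_srtrRealization_of_isMinimal`).

If the network is not minimal, observability leaves only a failure of reachability: some `w ≠ 0`
annihilates all reachable states. Adding `v wᵀ` to `A` does not affect `G`, but it can create an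
eigenvalue `μ` that `A` does not have. An SRTR pair built from the altered network can be chosen so
that `(λI - W)⁻¹` has a pole at `μ`. For a pair given by (∗), the poles of `(λI - W)⁻¹` are
eigenvalues of `A`, so this pair is not of that form (`exists_isSRTRPair_not_srtrRealization`). -/

noncomputable section

namespace SRTR

/-! ### The valuation at infinity and the polynomial part of a rational function -/

open Classical in
/-- The valuation at infinity on `ℝ(λ)`. -/
def valInfty : Valuation (RatFunc ℝ) (WithZero (Multiplicative ℤ)) := RatFunc.inftyValuation ℝ

theorem valInfty_of_ne_zero {f : RatFunc ℝ} (hf : f ≠ 0) :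
    valInfty f = WithZero.exp f.intDegree :=
  by classical exact RatFunc.inftyValuation_of_nonzero ℝ hf

theorem valInfty_le_one_iff (f : RatFunc ℝ) :
    valInfty f ≤ 1 ↔ f.num.natDegree ≤ f.denom.natDegree := by
  by_cases hf : f = 0
  · simp [hf]
  · rw [valInfty_of_ne_zero hf, ← WithZero.exp_zero, WithZero.exp_le_exp, RatFunc.intDegree]
    omega

theorem valInfty_lt_one_iff {f : RatFunc ℝ} (hf : f ≠ 0) :
    valInfty f < 1 ↔ f.intDegree < 0 := by
  rw [valInfty_of_ne_zero hf, ← WithZero.exp_zero, WithZero.exp_lt_exp]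

theorem isProper_iff {p m : Type*} (G : TFM p m) : IsProper G ↔ ∀ i j, valInfty (G i j) ≤ 1 := by
  simp only [IsProper, valInfty_le_one_iff]

theorem valInfty_C_le_one (a : ℝ) : valInfty (RatFunc.C a) ≤ 1 := by
  rw [valInfty_le_one_iff]; simp

theorem valInfty_X_mul_le_one {f : RatFunc ℝ} (hf : valInfty f < 1) :
    valInfty (RatFunc.X * f) ≤ 1 := by
  by_cases h : f = 0
  · simp [h]
  · have h1 := (valInfty_lt_one_iff h).1 hf
    rw [valInfty_of_ne_zero (mul_ne_zero RatFunc.X_ne_zero h),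
      RatFunc.intDegree_mul RatFunc.X_ne_zero h, RatFunc.intDegree_X, ← WithZero.exp_zero,
      WithZero.exp_le_exp]
    omega

/-- Each factor `X` raises the degree by one, so for `f ≠ 0` the exponent `|deg f|` already makes
the degree nonnegative. -/
theorem eq_zero_of_valInfty_X_pow_mul_lt_one {f : RatFunc ℝ}
    (hf : ∀ k : ℕ, valInfty (RatFunc.X ^ k * f) < 1) : f = 0 := by
  by_contra h
  have h1 := hf f.intDegree.natAbs
  have hX (k : ℕ) : (RatFunc.X ^ k : RatFunc ℝ) ≠ 0 := pow_ne_zero _ RatFunc.X_ne_zero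
  have hdeg (k : ℕ) : (RatFunc.X ^ k : RatFunc ℝ).intDegree = k := by
    rw [← RatFunc.algebraMap_X, ← map_pow, RatFunc.intDegree_polynomial, natDegree_X_pow]
  rw [valInfty_lt_one_iff (mul_ne_zero (hX _) h), RatFunc.intDegree_mul (hX _) h, hdeg] at h1
  omega

theorem eq_zero_of_valInfty_algebraMap_lt_one {P : ℝ[X]}
    (hP : valInfty (algebraMap ℝ[X] (RatFunc ℝ) P) < 1) : P = 0 := by
  by_contra h
  have h0 : algebraMap ℝ[X] (RatFunc ℝ) P ≠ 0 := by simpa using h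
  rw [valInfty_lt_one_iff h0, RatFunc.intDegree_polynomial] at hP
  omega

theorem eq_C_of_valInfty_algebraMap_le_one {P : ℝ[X]}
    (hP : valInfty (algebraMap ℝ[X] (RatFunc ℝ) P) ≤ 1) : P = Polynomial.C (P.coeff 0) := by
  rw [valInfty_le_one_iff] at hP
  simp only [RatFunc.num_algebraMap, RatFunc.denom_algebraMap, natDegree_one] at hP
  exact eq_C_of_natDegree_le_zero hP

theorem exists_sub_valInfty_lt_one (f : RatFunc ℝ) :
    ∃ P : ℝ[X], valInfty (f - algebraMap ℝ[X] (RatFunc ℝ) P) < 1 := by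
  refine ⟨f.num /ₘ f.denom, ?_⟩
  have hd : algebraMap ℝ[X] (RatFunc ℝ) f.denom ≠ 0 := by simpa using f.denom_ne_zero
  have h : f - algebraMap ℝ[X] (RatFunc ℝ) (f.num /ₘ f.denom) =
      algebraMap ℝ[X] (RatFunc ℝ) (f.num %ₘ f.denom) / algebraMap ℝ[X] (RatFunc ℝ) f.denom := by
    rw [eq_div_iff hd, sub_mul]
    nth_rw 1 [← RatFunc.num_div_denom f]
    rw [div_mul_cancel₀ _ hd, ← map_mul, ← map_sub]
    congr 1
    rw [sub_eq_iff_eq_add, mul_comm _ f.denom, modByMonic_add_div]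
  rw [h]
  by_cases h0 : f.num %ₘ f.denom = 0
  · simp [h0]
  have h0' : algebraMap ℝ[X] (RatFunc ℝ) (f.num %ₘ f.denom) ≠ 0 := by simpa using h0
  rw [valInfty_lt_one_iff (div_ne_zero h0' hd), RatFunc.intDegree_div h0' hd,
    RatFunc.intDegree_polynomial, RatFunc.intDegree_polynomial]
  have := natDegree_lt_natDegree h0 (degree_modByMonic_lt f.num f.monic_denom)
  omega

theorem eq_of_sub_valInfty_lt_one {f : RatFunc ℝ} {P Q : ℝ[X]}
    (hP : valInfty (f - algebraMap ℝ[X] (RatFunc ℝ) P) < 1)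
    (hQ : valInfty (f - algebraMap ℝ[X] (RatFunc ℝ) Q) < 1) : P = Q := by
  rw [← sub_eq_zero]
  apply eq_zero_of_valInfty_algebraMap_lt_one
  have h := Valuation.map_sub_lt valInfty hQ hP
  rwa [sub_sub_sub_cancel_left, ← map_sub] at h

/-- The polynomial part of a rational function. -/
def polyPart : RatFunc ℝ →ₗ[ℝ] ℝ[X] where
  toFun f := (exists_sub_valInfty_lt_one f).choose
  map_add' f g := by
    refine eq_of_sub_valInfty_lt_one (exists_sub_valInfty_lt_one (f + g)).choose_spec ?_
    rw [map_add, add_sub_add_comm]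
    exact Valuation.map_add_lt _ (exists_sub_valInfty_lt_one f).choose_spec
      (exists_sub_valInfty_lt_one g).choose_spec
  map_smul' a f := by
    refine eq_of_sub_valInfty_lt_one (exists_sub_valInfty_lt_one (a • f)).choose_spec ?_
    rw [RingHom.id_apply, Polynomial.smul_eq_C_mul, map_mul, RatFunc.algebraMap_C,
      RatFunc.smul_eq_C_mul, ← mul_sub, map_mul]
    exact (mul_le_of_le_one_left' (valInfty_C_le_one a)).trans_lt
      (exists_sub_valInfty_lt_one f).choose_spec

theorem valInfty_sub_polyPart (f : RatFunc ℝ) :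
    valInfty (f - algebraMap ℝ[X] (RatFunc ℝ) (polyPart f)) < 1 :=
  (exists_sub_valInfty_lt_one f).choose_spec

theorem polyPart_eq_of_valInfty_sub_lt_one {f : RatFunc ℝ} {P : ℝ[X]}
    (hP : valInfty (f - algebraMap ℝ[X] (RatFunc ℝ) P) < 1) : polyPart f = P :=
  eq_of_sub_valInfty_lt_one (valInfty_sub_polyPart f) hP

theorem polyPart_algebraMap (P : ℝ[X]) : polyPart (algebraMap ℝ[X] (RatFunc ℝ) P) = P :=
  polyPart_eq_of_valInfty_sub_lt_one (by simp)

theorem polyPart_eq_zero {f : RatFunc ℝ} (hf : valInfty f < 1) : polyPart f = 0 :=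
  polyPart_eq_of_valInfty_sub_lt_one (by simpa using hf)

theorem polyPart_of_valInfty_le_one {f : RatFunc ℝ} (hf : valInfty f ≤ 1) :
    polyPart f = Polynomial.C ((polyPart f).coeff 0) := by
  apply eq_C_of_valInfty_algebraMap_le_one
  have h := Valuation.map_sub_le _ hf (valInfty_sub_polyPart f).le
  rwa [sub_sub_cancel] at h

/-- The strictly proper part of a rational function. -/
def properPart : RatFunc ℝ →ₗ[ℝ] RatFunc ℝ :=
  LinearMap.id - (IsScalarTower.toAlgHom ℝ ℝ[X] (RatFunc ℝ)).toLinearMap ∘ₗ polyPart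

theorem properPart_apply (f : RatFunc ℝ) :
    properPart f = f - algebraMap ℝ[X] (RatFunc ℝ) (polyPart f) := rfl

theorem valInfty_properPart (f : RatFunc ℝ) : valInfty (properPart f) < 1 :=
  valInfty_sub_polyPart f

theorem properPart_add_algebraMap {f : RatFunc ℝ} (hf : valInfty f < 1) (P : ℝ[X]) :
    properPart (f + algebraMap ℝ[X] (RatFunc ℝ) P) = f := by
  rw [properPart_apply, map_add, polyPart_eq_zero hf, polyPart_algebraMap, zero_add,
    add_sub_cancel_right]

theorem properPart_eq_zero_iff {f : RatFunc ℝ} :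
    properPart f = 0 ↔ ∃ P, f = algebraMap ℝ[X] (RatFunc ℝ) P := by
  refine ⟨fun h => ⟨polyPart f, sub_eq_zero.1 h⟩, ?_⟩
  rintro ⟨P, rfl⟩
  rw [properPart_apply, polyPart_algebraMap, sub_self]

/-! ### The resolvent -/

section Resolvent

variable {n m p : Type*} [Fintype n] [DecidableEq n]

/-- The matrix `(λI - A)⁻¹` over `ℝ(λ)`. -/
def resolvent (A : Matrix n n ℝ) : TFM n n :=
  ((RatFunc.X : RatFunc ℝ) • (1 : TFM n n) - A.map RatFunc.C)⁻¹

theorem map_charmatrix (A : Matrix n n ℝ) :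
    (charmatrix A).map (algebraMap ℝ[X] (RatFunc ℝ)) =
      (RatFunc.X : RatFunc ℝ) • (1 : TFM n n) - A.map RatFunc.C := by
  ext i j
  by_cases h : i = j
  · subst h; simp
  · simp [h]

theorem det_X_sub (A : Matrix n n ℝ) :
    ((RatFunc.X : RatFunc ℝ) • (1 : TFM n n) - A.map RatFunc.C).det =
      algebraMap ℝ[X] (RatFunc ℝ) A.charpoly := by
  rw [← map_charmatrix, ← RingHom.mapMatrix_apply, ← RingHom.map_det]; rfl

theorem isUnit_det_X_sub (A : Matrix n n ℝ) :
    IsUnit ((RatFunc.X : RatFunc ℝ) • (1 : TFM n n) - A.map RatFunc.C).det := by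
  rw [det_X_sub, isUnit_iff_ne_zero]
  simpa using A.charpoly_monic.ne_zero

theorem X_sub_mul_resolvent (A : Matrix n n ℝ) :
    ((RatFunc.X : RatFunc ℝ) • (1 : TFM n n) - A.map RatFunc.C) * resolvent A = 1 :=
  mul_nonsing_inv _ (isUnit_det_X_sub A)

theorem resolvent_mul_X_sub (A : Matrix n n ℝ) :
    resolvent A * ((RatFunc.X : RatFunc ℝ) • (1 : TFM n n) - A.map RatFunc.C) = 1 :=
  nonsing_inv_mul _ (isUnit_det_X_sub A)

theorem X_smul_resolvent (A : Matrix n n ℝ) :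
    (RatFunc.X : RatFunc ℝ) • resolvent A = 1 + resolvent A * A.map RatFunc.C := by
  have h := resolvent_mul_X_sub A
  rw [mul_sub, mul_smul_comm, mul_one, sub_eq_iff_eq_add] at h
  exact h

theorem charpoly_smul_resolvent (A : Matrix n n ℝ) :
    algebraMap ℝ[X] (RatFunc ℝ) A.charpoly • resolvent A =
      (adjugate (charmatrix A)).map (algebraMap ℝ[X] (RatFunc ℝ)) := by
  rw [resolvent, Matrix.inv_def, det_X_sub, smul_smul, Ring.mul_inverse_cancel, one_smul,
    ← map_charmatrix, ← RingHom.mapMatrix_apply, ← RingHom.map_adjugate]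
  · rfl
  · rw [← det_X_sub]; exact isUnit_det_X_sub A

theorem eq_mul_resolvent {A : Matrix n n ℝ} {S T : TFM p n}
    (h : S * ((RatFunc.X : RatFunc ℝ) • (1 : TFM n n) - A.map RatFunc.C) = T) :
    S = T * resolvent A := by
  rw [← h, Matrix.mul_assoc, X_sub_mul_resolvent, Matrix.mul_one]

theorem eq_resolvent_mul {A : Matrix n n ℝ} {S T : TFM n p}
    (h : ((RatFunc.X : RatFunc ℝ) • (1 : TFM n n) - A.map RatFunc.C) * S = T) :
    S = resolvent A * T := by
  rw [← h, ← Matrix.mul_assoc, resolvent_mul_X_sub, Matrix.one_mul]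

theorem StateSpace.tfm_eq_resolvent (S : StateSpace n m p) :
    S.tfm = S.D.map RatFunc.C + S.C.map RatFunc.C * resolvent S.A * S.B.map RatFunc.C := rfl

/-- Take an entry of largest valuation in row `i`. If it were at least `1`, the identity `λR = 1 +
RA` would bound `λ` times this entry by the entry itself, although `λ` has valuation greater than
`1`. -/
theorem valInfty_resolvent (A : Matrix n n ℝ) (i j : n) : valInfty (resolvent A i j) < 1 := by
  obtain ⟨k, -, hk⟩ := Finset.exists_max_image Finset.univ (fun k => valInfty (resolvent A i k))
    ⟨j, Finset.mem_univ j⟩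
  by_contra! hj
  have hk1 : 1 ≤ valInfty (resolvent A i k) := hj.trans (hk j (Finset.mem_univ j))
  have hX : 1 < valInfty (RatFunc.X : RatFunc ℝ) := by
    rw [valInfty_of_ne_zero RatFunc.X_ne_zero, RatFunc.intDegree_X, ← WithZero.exp_zero,
      WithZero.exp_lt_exp]
    exact one_pos
  have hle : valInfty (RatFunc.X * resolvent A i k) ≤ valInfty (resolvent A i k) := by
    have h := congrFun (congrFun (X_smul_resolvent A) i) k
    rw [Matrix.smul_apply, smul_eq_mul] at h
    rw [h, Matrix.add_apply, Matrix.mul_apply]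
    refine Valuation.map_add_le _ (le_trans ?_ hk1) (Valuation.map_sum_le _ fun l _ => ?_)
    · by_cases hik : i = k
      · subst hik; simp
      · simp [hik]
    · rw [map_mul]
      exact (mul_le_of_le_one_right' (valInfty_C_le_one _)).trans (hk l (Finset.mem_univ l))
  rw [map_mul] at hle
  have h0 : (0 : WithZero (Multiplicative ℤ)) < valInfty (resolvent A i k) :=
    lt_of_lt_of_le zero_lt_one hk1
  exact absurd hle (not_le.2 (lt_mul_left h0 hX))

theorem valInfty_mul_resolvent_mul_lt_one {k l : Type*} (A : Matrix n n ℝ) (L : Matrix k n ℝ)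
    (R : Matrix n l ℝ) (i : k) (j : l) :
    valInfty ((L.map RatFunc.C * resolvent A * R.map RatFunc.C) i j) < 1 := by
  rw [Matrix.mul_apply]
  refine Valuation.map_sum_lt _ one_ne_zero fun a _ => ?_
  rw [map_mul, Matrix.mul_apply]
  refine (mul_le_of_le_one_right' (valInfty_C_le_one _)).trans_lt
    (Valuation.map_sum_lt _ one_ne_zero fun b _ => ?_)
  rw [map_mul]
  exact (mul_le_of_le_one_left' (valInfty_C_le_one _)).trans_lt (valInfty_resolvent A b a)

theorem StateSpace.isProper_tfm (S : StateSpace n m p) : IsProper S.tfm := by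
  rw [isProper_iff]
  intro i j
  rw [S.tfm_eq_resolvent, Matrix.add_apply]
  exact Valuation.map_add_le _ (valInfty_C_le_one _)
    (valInfty_mul_resolvent_mul_lt_one S.A S.C S.B i j).le

end Resolvent

/-! ### The response module of a transfer function matrix -/

/-- The coefficient of `1/λ` of a strictly proper rational function. -/
def leadCoeffInfty : RatFunc ℝ →ₗ[ℝ] ℝ :=
  Polynomial.lcoeff ℝ 0 ∘ₗ polyPart ∘ₗ LinearMap.mulLeft ℝ RatFunc.X

theorem leadCoeffInfty_apply (f : RatFunc ℝ) :
    leadCoeffInfty f = (polyPart (RatFunc.X * f)).coeff 0 := rfl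

theorem properPart_X_mul {f : RatFunc ℝ} (hf : valInfty f < 1) :
    properPart (RatFunc.X * f) = RatFunc.X * f - RatFunc.C (leadCoeffInfty f) := by
  rw [properPart_apply, polyPart_of_valInfty_le_one (valInfty_X_mul_le_one hf),
    RatFunc.algebraMap_C, leadCoeffInfty_apply]

/-- Multiplication of polynomial inputs by `λ`. -/
def shift (m : Type*) : (m → ℝ[X]) →ₗ[ℝ] (m → ℝ[X]) := Algebra.lsmul ℝ ℝ (m → ℝ[X]) (X : ℝ[X])

theorem shift_apply {m : Type*} (u : m → ℝ[X]) : shift m u = (X : ℝ[X]) • u := rfl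

/-- Coordinate-free realization: `a`, `b`, `c` are the state, input and output maps, and `s z` plays
the role of `c(λ - a)⁻¹z`. In a basis, `hs` becomes `T(λI - A) = C`, which determines `T = C(λI -
A)⁻¹`. -/
theorem exists_realization {m p Z : Type*} [AddCommGroup Z] [Module ℝ Z] [FiniteDimensional ℝ Z]
    (a : Z →ₗ[ℝ] Z) (b : m → Z) (c : Z →ₗ[ℝ] (p → ℝ)) (s : Z →ₗ[ℝ] (p → RatFunc ℝ))
    (D : Matrix p m ℝ) (G : TFM p m)
    (hs : ∀ z i, s (a z) i = RatFunc.X * s z i - RatFunc.C (c z i))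
    (hG : ∀ i j, G i j = RatFunc.C (D i j) + s (b j) i) :
    ∃ S : StateSpace (Fin (Module.finrank ℝ Z)) m p, S.tfm = G := by
  let e := Module.finBasis ℝ Z
  have hsum (z : Z) (i : p) : ∑ k, s (e k) i * RatFunc.C (e.repr z k) = s z i := by
    conv_rhs => rw [← e.sum_repr z]
    rw [map_sum, Finset.sum_apply]
    refine Finset.sum_congr rfl fun k _ => ?_
    rw [map_smul, Pi.smul_apply, RatFunc.smul_eq_C_mul, mul_comm]
  let S : StateSpace (Fin (Module.finrank ℝ Z)) m p :=
    ⟨Matrix.of fun k l => e.repr (a (e l)) k, Matrix.of fun k j => e.repr (b j) k,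
      Matrix.of fun i k => c (e k) i, D⟩
  let T : TFM p (Fin (Module.finrank ℝ Z)) := Matrix.of fun i k => s (e k) i
  have hT : T * ((RatFunc.X : RatFunc ℝ) • (1 : TFM _ _) - S.A.map RatFunc.C) =
      S.C.map RatFunc.C := by
    ext i l
    rw [Matrix.mul_sub, Matrix.mul_smul, Matrix.mul_one, Matrix.sub_apply, Matrix.smul_apply,
      Matrix.mul_apply]
    simp only [S, T, Matrix.of_apply, Matrix.map_apply, smul_eq_mul]
    rw [hsum, hs, sub_sub_cancel]
  refine ⟨S, ?_⟩
  ext i j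
  rw [S.tfm_eq_resolvent, ← eq_mul_resolvent hT, Matrix.add_apply, Matrix.mul_apply, hG]
  simp only [S, T, Matrix.of_apply, Matrix.map_apply]
  rw [hsum]

section Response

variable {n m p : Type*} [Fintype m]

/-- The strictly proper part of the response `G u` to a polynomial input `u`. -/
def strictOutput (G : TFM p m) : (m → ℝ[X]) →ₗ[ℝ] (p → RatFunc ℝ) :=
  LinearMap.pi fun i => ∑ j, properPart ∘ₗ LinearMap.mulLeft ℝ (G i j) ∘ₗ
    (IsScalarTower.toAlgHom ℝ ℝ[X] (RatFunc ℝ)).toLinearMap ∘ₗ LinearMap.proj j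

theorem strictOutput_apply (G : TFM p m) (u : m → ℝ[X]) (i : p) :
    strictOutput G u i = properPart (∑ j, G i j * algebraMap ℝ[X] (RatFunc ℝ) (u j)) := by
  simp [strictOutput]

theorem valInfty_strictOutput (G : TFM p m) (u : m → ℝ[X]) (i : p) :
    valInfty (strictOutput G u i) < 1 := by
  rw [strictOutput_apply]; exact valInfty_properPart _

/-- The polynomial part of the response stays polynomial after multiplication by `λ`, so only the
strictly proper part matters. This makes the kernel stable under the shift. -/
theorem strictOutput_X_smul (G : TFM p m) (u : m → ℝ[X]) (i : p) :
    strictOutput G ((X : ℝ[X]) • u) i = RatFunc.X * strictOutput G u i -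
      RatFunc.C (leadCoeffInfty (strictOutput G u i)) := by
  rw [← properPart_X_mul (valInfty_strictOutput G u i), strictOutput_apply, strictOutput_apply]
  set f := ∑ j, G i j * algebraMap ℝ[X] (RatFunc ℝ) (u j) with hf
  have h1 : ∑ j, G i j * algebraMap ℝ[X] (RatFunc ℝ) (((X : ℝ[X]) • u) j) = RatFunc.X * f := by
    rw [hf, Finset.mul_sum]
    refine Finset.sum_congr rfl fun j _ => ?_
    rw [Pi.smul_apply, smul_eq_mul, map_mul, RatFunc.algebraMap_X, mul_left_comm]
  have h2 : RatFunc.X * f = RatFunc.X * properPart f +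
      algebraMap ℝ[X] (RatFunc ℝ) (X * polyPart f) := by
    rw [properPart_apply, map_mul, RatFunc.algebraMap_X]; ring
  rw [h1, h2, map_add, (properPart_eq_zero_iff (f := algebraMap ℝ[X] (RatFunc ℝ) _)).2 ⟨_, rfl⟩,
    add_zero]

theorem mem_ker_strictOutput {G : TFM p m} {u : m → ℝ[X]} :
    u ∈ LinearMap.ker (strictOutput G) ↔
      ∃ P : p → ℝ[X], ∀ i, ∑ j, G i j * algebraMap ℝ[X] (RatFunc ℝ) (u j) =
        algebraMap ℝ[X] (RatFunc ℝ) (P i) := by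
  rw [LinearMap.mem_ker, funext_iff]
  simp only [strictOutput_apply, Pi.zero_apply, properPart_eq_zero_iff]
  exact Classical.skolem

/-- The polynomial inputs modulo those with a polynomial response. -/
abbrev ResponseModule (G : TFM p m) : Type _ := (m → ℝ[X]) ⧸ LinearMap.ker (strictOutput G)

theorem ker_strictOutput_le_comap_shift (G : TFM p m) :
    LinearMap.ker (strictOutput G) ≤ (LinearMap.ker (strictOutput G)).comap (shift m) := by
  intro u hu
  rw [LinearMap.mem_ker] at hu
  rw [Submodule.mem_comap, LinearMap.mem_ker, shift_apply]
  ext1 i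
  rw [strictOutput_X_smul, hu]
  simp

/-- The state space is the response module itself: the shift is the state map, the classes of the
unit inputs are the columns of `B`, and the output is the coefficient of `1/λ`. Properness makes the
polynomial part of `G` a constant matrix, which is `D`. -/
theorem IsProper.exists_realization [DecidableEq m] {G : TFM p m} (hG : IsProper G)
    [FiniteDimensional ℝ (ResponseModule G)] :
    ∃ S : StateSpace (Fin (Module.finrank ℝ (ResponseModule G))) m p, S.tfm = G := by
  let s : ResponseModule G →ₗ[ℝ] (p → RatFunc ℝ) :=
    (LinearMap.ker (strictOutput G)).liftQ (strictOutput G) le_rfl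
  let c : ResponseModule G →ₗ[ℝ] (p → ℝ) :=
    LinearMap.pi fun i => leadCoeffInfty ∘ₗ LinearMap.proj i ∘ₗ s
  refine SRTR.exists_realization
    ((LinearMap.ker (strictOutput G)).mapQ _ (shift m) (ker_strictOutput_le_comap_shift G))
    (fun j => Submodule.Quotient.mk (Pi.single j 1)) c s
    (Matrix.of fun i j => (polyPart (G i j)).coeff 0) G ?_ ?_
  · intro z i
    obtain ⟨u, rfl⟩ := Submodule.Quotient.mk_surjective _ z
    exact strictOutput_X_smul G u i
  · intro i j
    change _ = _ + strictOutput G (Pi.single j 1) i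
    have h : ∑ l, G i l * algebraMap ℝ[X] (RatFunc ℝ) ((Pi.single j 1 : m → ℝ[X]) l) = G i j := by
      rw [Finset.sum_eq_single j]
      · simp
      · intro l _ hl; simp [hl]
      · simp
    rw [strictOutput_apply, h, properPart_apply, Matrix.of_apply, ← RatFunc.algebraMap_C,
      ← polyPart_of_valInfty_le_one ((isProper_iff G).1 hG i j)]
    ring

end Response

theorem map_mulVec {n l : Type*} [Fintype n] (M : Matrix l n ℝ) (x : n → ℝ) :
    (fun k => RatFunc.C ((M *ᵥ x) k)) = M.map RatFunc.C *ᵥ fun k => RatFunc.C (x k) := by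
  ext1 k
  simp [Matrix.mulVec, dotProduct]

theorem map_ratFuncC {k l : Type*} (M : Matrix k l ℝ) :
    M.map RatFunc.C = (M.map Polynomial.C).map (algebraMap ℝ[X] (RatFunc ℝ)) := by
  ext i j
  rw [Matrix.map_apply, Matrix.map_apply, Matrix.map_apply, RatFunc.algebraMap_C]

/-! ### The zero-input response of a realization. -/

section FreeOutput

variable {n m p : Type*} [Fintype n] [DecidableEq n]

/-- The response of the output to an initial state. -/
def StateSpace.freeOutput (S : StateSpace n m p) : (n → ℝ) →ₗ[ℝ] (p → RatFunc ℝ) :=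
  LinearMap.pi fun i => ∑ k, (S.C.map RatFunc.C * resolvent S.A) i k •
    (Algebra.linearMap ℝ (RatFunc ℝ) ∘ₗ LinearMap.proj k)

theorem StateSpace.freeOutput_apply (S : StateSpace n m p) (x : n → ℝ) (i : p) :
    S.freeOutput x i = ∑ k, (S.C.map RatFunc.C * resolvent S.A) i k * RatFunc.C (x k) := by
  simp [StateSpace.freeOutput, RatFunc.algebraMap_eq_C]

theorem StateSpace.valInfty_freeOutput (S : StateSpace n m p) (x : n → ℝ) (i : p) :
    valInfty (S.freeOutput x i) < 1 := by
  have h := valInfty_mul_resolvent_mul_lt_one S.A S.C (Matrix.of fun k (_ : Unit) => x k) i ()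
  rw [Matrix.mul_apply] at h
  rw [freeOutput_apply]
  exact h

theorem StateSpace.X_mul_freeOutput (S : StateSpace n m p) (x : n → ℝ) (i : p) :
    RatFunc.X * S.freeOutput x i = S.freeOutput (S.A *ᵥ x) i + RatFunc.C ((S.C *ᵥ x) i) := by
  have h1 (y : n → ℝ) : S.freeOutput y =
      (S.C.map RatFunc.C * resolvent S.A) *ᵥ fun k => RatFunc.C (y k) := by
    ext1 i; exact S.freeOutput_apply y i
  have h3 : (RatFunc.X : RatFunc ℝ) • S.freeOutput x =
      S.freeOutput (S.A *ᵥ x) + fun i => RatFunc.C ((S.C *ᵥ x) i) := by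
    rw [h1, h1, map_mulVec, map_mulVec, Matrix.mulVec_mulVec, ← Matrix.add_mulVec,
      ← Matrix.smul_mulVec, ← Matrix.mul_smul, X_smul_resolvent, Matrix.mul_add, Matrix.mul_one,
      ← Matrix.mul_assoc, add_comm]
  exact congrFun h3 i

theorem StateSpace.leadCoeffInfty_freeOutput (S : StateSpace n m p) (x : n → ℝ) (i : p) :
    leadCoeffInfty (S.freeOutput x i) = (S.C *ᵥ x) i := by
  rw [leadCoeffInfty_apply, X_mul_freeOutput, map_add, polyPart_eq_zero (S.valInfty_freeOutput _ _),
    ← RatFunc.algebraMap_C, polyPart_algebraMap, zero_add, coeff_C_zero]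

end FreeOutput

/-! ### Reachable states, minimality and similarity of minimal realizations. -/

section Reach

variable {n m p : Type*} [Fintype n] [DecidableEq n] [Fintype m]

/-- The polynomial matrix `f(λ)I - f(A)` is divisible by `λI - A`. -/
theorem algebraMap_smul_resolvent (A : Matrix n n ℝ) (f : ℝ[X]) :
    ∃ Q : Matrix n n ℝ[X], algebraMap ℝ[X] (RatFunc ℝ) f • resolvent A =
      resolvent A * (aeval A f).map RatFunc.C + Q.map (algebraMap ℝ[X] (RatFunc ℝ)) := by
  induction f using Polynomial.induction_on' with
  | add f g hf hg =>
    obtain ⟨Q, hQ⟩ := hf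
    obtain ⟨R, hR⟩ := hg
    refine ⟨Q + R, ?_⟩
    rw [map_add, add_smul, hQ, hR, map_add, Matrix.map_add _ (map_add _),
      Matrix.map_add _ (map_add _), mul_add]
    abel
  | monomial k a =>
    induction k with
    | zero =>
      refine ⟨0, ?_⟩
      rw [monomial_zero_left, aeval_C, RatFunc.algebraMap_C, Matrix.map_zero _ (map_zero _),
        add_zero, Algebra.algebraMap_eq_smul_one]
      have : (a • (1 : Matrix n n ℝ)).map RatFunc.C = RatFunc.C a • (1 : TFM n n) := by
        ext i j
        by_cases h : i = j
        · subst h; simp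
        · simp [h]
      rw [this, mul_smul_comm, mul_one]
    | succ k ih =>
      obtain ⟨Q, hQ⟩ := ih
      refine ⟨(aeval A (monomial k a)).map Polynomial.C + (X : ℝ[X]) • Q, ?_⟩
      have h1 : (monomial (k + 1) a : ℝ[X]) = X * monomial k a := by rw [X_mul_monomial]
      have h2 : ((X : ℝ[X]) • Q).map (algebraMap ℝ[X] (RatFunc ℝ)) =
          (RatFunc.X : RatFunc ℝ) • Q.map (algebraMap ℝ[X] (RatFunc ℝ)) := by
        ext i j; simp
      rw [h1, map_mul, RatFunc.algebraMap_X, ← smul_smul, hQ, smul_add, ← smul_mul_assoc,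
        X_smul_resolvent, map_mul, aeval_X, Matrix.map_mul, Matrix.map_add _ (map_add _), h2,
        ← map_ratFuncC, add_mul, one_mul, Matrix.mul_assoc]
      abel

/-- The state that a polynomial input generates from the zero state. -/
def StateSpace.reach (S : StateSpace n m p) : (m → ℝ[X]) →ₗ[ℝ] (n → ℝ) :=
  ∑ j, LinearMap.applyₗ (fun i => S.B i j) ∘ₗ Matrix.mulVecBilin ℝ ℝ ∘ₗ
    (aeval S.A).toLinearMap ∘ₗ LinearMap.proj j

theorem StateSpace.reach_apply (S : StateSpace n m p) (u : m → ℝ[X]) :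
    S.reach u = ∑ j, aeval S.A (u j) *ᵥ fun i => S.B i j := by
  simp [StateSpace.reach]

theorem StateSpace.reach_shift (S : StateSpace n m p) (u : m → ℝ[X]) :
    S.reach (shift m u) = S.A *ᵥ S.reach u := by
  rw [reach_apply, reach_apply, Matrix.mulVec_sum]
  refine Finset.sum_congr rfl fun j _ => ?_
  rw [shift_apply, Pi.smul_apply, smul_eq_mul, map_mul, aeval_X, Matrix.mulVec_mulVec]

theorem StateSpace.reach_single [DecidableEq m] (S : StateSpace n m p) (j : m) (f : ℝ[X]) :
    S.reach (Pi.single j f) = aeval S.A f *ᵥ fun i => S.B i j := by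
  rw [reach_apply, Finset.sum_eq_single j]
  · rw [Pi.single_eq_same]
  · intro l _ hl; rw [Pi.single_eq_of_ne hl, map_zero, Matrix.zero_mulVec]
  · simp

/-- Modulo polynomials, `f(λ)(λI - A)⁻¹` is `(λI - A)⁻¹f(A)`. Thus an input acts on the strictly
proper part of the output only through the state it reaches. -/
theorem StateSpace.strictOutput_tfm (S : StateSpace n m p) (u : m → ℝ[X]) :
    strictOutput S.tfm u = S.freeOutput (S.reach u) := by
  classical
  suffices h : strictOutput S.tfm = S.freeOutput ∘ₗ S.reach from LinearMap.congr_fun h u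
  refine LinearMap.pi_ext fun j f => ?_
  ext1 i
  rw [LinearMap.comp_apply, reach_single, strictOutput_apply, Finset.sum_eq_single j,
    Pi.single_eq_same]
  rotate_left
  · intro l _ hl; rw [Pi.single_eq_of_ne hl, map_zero, mul_zero]
  · simp
  obtain ⟨Q, hQ⟩ := algebraMap_smul_resolvent S.A f
  have h1 : S.tfm i j * algebraMap ℝ[X] (RatFunc ℝ) f =
      (S.C.map RatFunc.C * resolvent S.A * (aeval S.A f * S.B).map RatFunc.C) i j +
        algebraMap ℝ[X] (RatFunc ℝ) (Polynomial.C (S.D i j) * f +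
          (S.C.map Polynomial.C * Q * S.B.map Polynomial.C) i j) := by
    have h2 : algebraMap ℝ[X] (RatFunc ℝ) ((S.C.map Polynomial.C * Q * S.B.map Polynomial.C) i j) =
        (S.C.map RatFunc.C * Q.map (algebraMap ℝ[X] (RatFunc ℝ)) * S.B.map RatFunc.C) i j := by
      rw [map_ratFuncC, map_ratFuncC, ← Matrix.map_mul, ← Matrix.map_mul, Matrix.map_apply]
    have h4 : (S.C.map RatFunc.C * (algebraMap ℝ[X] (RatFunc ℝ) f • resolvent S.A) *
        S.B.map RatFunc.C) i j = (S.C.map RatFunc.C * (resolvent S.A * (aeval S.A f).map RatFunc.C +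
          Q.map (algebraMap ℝ[X] (RatFunc ℝ))) * S.B.map RatFunc.C) i j := by rw [hQ]
    simp only [Matrix.mul_smul, Matrix.smul_mul, Matrix.smul_apply, Matrix.mul_add, Matrix.add_mul,
      Matrix.add_apply, smul_eq_mul] at h4
    rw [S.tfm_eq_resolvent, Matrix.add_apply, add_mul, mul_comm _ (algebraMap _ _ f),
      mul_comm _ (algebraMap _ _ f), h4, map_add, h2, map_mul, RatFunc.algebraMap_C,
      Matrix.map_mul, Matrix.map_apply]
    simp only [Matrix.mul_assoc]
    ring
  rw [h1, properPart_add_algebraMap (valInfty_mul_resolvent_mul_lt_one _ _ _ _ _),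
    freeOutput_apply, Matrix.mul_apply]
  rfl

theorem StateSpace.ker_reach_le (S : StateSpace n m p) :
    LinearMap.ker S.reach ≤ LinearMap.ker (strictOutput S.tfm) := by
  intro u hu
  rw [LinearMap.mem_ker] at hu ⊢
  rw [strictOutput_tfm, hu, map_zero]

instance (S : StateSpace n m p) : FiniteDimensional ℝ ((m → ℝ[X]) ⧸ LinearMap.ker S.reach) :=
  Module.Finite.equiv S.reach.quotKerEquivRange.symm

theorem StateSpace.finiteDimensional_responseModule (S : StateSpace n m p) :
    FiniteDimensional ℝ (ResponseModule S.tfm) :=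
  Module.Finite.of_surjective _ (Submodule.factor_surjective S.ker_reach_le)

theorem StateSpace.finrank_responseModule_le_finrank_range (S : StateSpace n m p) :
    Module.finrank ℝ (ResponseModule S.tfm) ≤ Module.finrank ℝ (LinearMap.range S.reach) := by
  rw [← S.reach.quotKerEquivRange.finrank_eq]
  exact LinearMap.finrank_le_finrank_of_surjective (Submodule.factor_surjective S.ker_reach_le)

/-- The response module is a quotient of the space of reachable states. -/
theorem StateSpace.finrank_responseModule_le (S : StateSpace n m p) :
    Module.finrank ℝ (ResponseModule S.tfm) ≤ Fintype.card n := by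
  refine S.finrank_responseModule_le_finrank_range.trans ?_
  rw [← Module.finrank_fintype_fun_eq_card ℝ (η := n)]
  exact Submodule.finrank_le _

theorem StateSpace.IsMinimal.card_le [DecidableEq m] {S : StateSpace n m p} (hS : S.IsMinimal) :
    Fintype.card n ≤ Module.finrank ℝ (ResponseModule S.tfm) := by
  have := S.finiteDimensional_responseModule
  obtain ⟨S', hS'⟩ := S.isProper_tfm.exists_realization
  exact hS _ S' hS'

theorem StateSpace.isMinimal_of_card_le {S : StateSpace n m p}
    (hS : Fintype.card n ≤ Module.finrank ℝ (ResponseModule S.tfm)) : S.IsMinimal := by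
  intro k S' hS'
  rw [← hS'] at hS
  simpa using hS.trans S'.finrank_responseModule_le

theorem StateSpace.range_reach {S : StateSpace n m p}
    (hS : Fintype.card n ≤ Module.finrank ℝ (ResponseModule S.tfm)) :
    LinearMap.range S.reach = ⊤ := by
  apply Submodule.eq_top_of_finrank_eq
  refine le_antisymm (Submodule.finrank_le _) ?_
  rw [Module.finrank_fintype_fun_eq_card]
  exact hS.trans S.finrank_responseModule_le_finrank_range

/-- The reachable space surjects onto the response module. When the dimensions agree this surjection
is injective, so distinct states have distinct responses. -/
theorem StateSpace.ker_reach {S : StateSpace n m p}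
    (hS : Fintype.card n ≤ Module.finrank ℝ (ResponseModule S.tfm)) :
    LinearMap.ker S.reach = LinearMap.ker (strictOutput S.tfm) := by
  have := S.finiteDimensional_responseModule
  refine le_antisymm S.ker_reach_le ?_
  have hle : Module.finrank ℝ ((m → ℝ[X]) ⧸ LinearMap.ker S.reach) ≤ Fintype.card n := by
    rw [S.reach.quotKerEquivRange.finrank_eq, ← Module.finrank_fintype_fun_eq_card ℝ (η := n)]
    exact Submodule.finrank_le _
  have hsurj := Submodule.factor_surjective S.ker_reach_le
  have heq : Module.finrank ℝ ((m → ℝ[X]) ⧸ LinearMap.ker S.reach) =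
      Module.finrank ℝ (ResponseModule S.tfm) :=
    le_antisymm (hle.trans hS) (LinearMap.finrank_le_finrank_of_surjective hsurj)
  have hinj := (LinearMap.injective_iff_surjective_of_finrank_eq_finrank heq).2 hsurj
  intro u hu
  rw [← Submodule.Quotient.mk_eq_zero] at hu ⊢
  exact hinj (by rw [map_zero]; exact hu)

theorem StateSpace.ext_of_mulVec_reach {S : StateSpace n m p}
    (hS : Fintype.card n ≤ Module.finrank ℝ (ResponseModule S.tfm)) {l : Type*}
    {M N : Matrix l n ℝ} (h : ∀ u, M *ᵥ S.reach u = N *ᵥ S.reach u) : M = N := by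
  refine Matrix.ext_of_mulVec_single fun i => ?_
  obtain ⟨u, hu⟩ := LinearMap.range_eq_top.1 (range_reach hS) (Pi.single i 1)
  rw [← hu, h]

/-- Two realizations of least order of the same TFM are similar. -/
theorem StateSpace.exists_similarity [DecidableEq m] {S S' : StateSpace n m p} (h : S'.tfm = S.tfm)
    (hS : Fintype.card n ≤ Module.finrank ℝ (ResponseModule S.tfm)) :
    ∃ T : Matrix n n ℝ, IsUnit T.det ∧ S'.A * T = T * S.A ∧ T * S.B = S'.B ∧ S'.C * T = S.C := by
  have hS' : Fintype.card n ≤ Module.finrank ℝ (ResponseModule S'.tfm) := by rwa [h]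
  have hker : LinearMap.ker S.reach = LinearMap.ker S'.reach := by
    rw [ker_reach hS, ker_reach hS', h]
  -- Both state spaces are the quotient of the inputs by the same kernel; `e` sends the state that
  -- `u` reaches in `S` to the one it reaches in `S'`.
  let e : (n → ℝ) ≃ₗ[ℝ] (n → ℝ) :=
    (S.reach.quotKerEquivOfSurjective (LinearMap.range_eq_top.1 (range_reach hS))).symm ≪≫ₗ
      Submodule.quotEquivOfEq _ _ hker ≪≫ₗ
      S'.reach.quotKerEquivOfSurjective (LinearMap.range_eq_top.1 (range_reach hS'))
  have he (u : m → ℝ[X]) : e (S.reach u) = S'.reach u := by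
    have : (S.reach.quotKerEquivOfSurjective (LinearMap.range_eq_top.1 (range_reach hS))).symm
        (S.reach u) = Submodule.Quotient.mk u := by
      rw [LinearEquiv.symm_apply_eq]; rfl
    simp only [e, LinearEquiv.trans_apply, this]
    rfl
  let T := LinearMap.toMatrix' (e : (n → ℝ) →ₗ[ℝ] (n → ℝ))
  have hT (u : m → ℝ[X]) : T *ᵥ S.reach u = S'.reach u := by
    rw [← he, LinearMap.toMatrix'_mulVec]; rfl
  refine ⟨T, ?_, ext_of_mulVec_reach hS fun u => ?_, ?_, ext_of_mulVec_reach hS fun u => ?_⟩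
  · rw [LinearMap.det_toMatrix']; exact e.isUnit_det'
  · rw [← Matrix.mulVec_mulVec, ← Matrix.mulVec_mulVec, hT, ← reach_shift, ← reach_shift, hT]
  · ext i j
    have h1 := hT (Pi.single j 1)
    rw [reach_single, reach_single, map_one, map_one, Matrix.one_mulVec, Matrix.one_mulVec] at h1
    exact congrFun h1 i
  · rw [← Matrix.mulVec_mulVec, hT]
    ext1 i
    rw [← leadCoeffInfty_freeOutput, ← leadCoeffInfty_freeOutput, ← strictOutput_tfm,
      ← strictOutput_tfm, h]

/-- A realization whose state can be recovered from the output and in which every state is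
reachable has the least order. -/
theorem StateSpace.isMinimal_of_range_reach {S : StateSpace n m p}
    (hobs : ∀ x : n → ℝ, (∀ k : ℕ, S.C *ᵥ (S.A ^ k *ᵥ x) = 0) → x = 0)
    (hS : LinearMap.range S.reach = ⊤) : S.IsMinimal := by
  apply isMinimal_of_card_le
  have hfree (x : n → ℝ) (hx : S.freeOutput x = 0) : x = 0 := by
    have h1 (k : ℕ) : S.freeOutput (S.A ^ k *ᵥ x) = 0 := by
      induction k with
      | zero => simpa using hx
      | succ k ih =>
        ext1 i
        have h2 := S.X_mul_freeOutput (S.A ^ k *ᵥ x) i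
        rw [← leadCoeffInfty_freeOutput, ih, Pi.zero_apply, map_zero, mul_zero, map_zero, add_zero,
          Matrix.mulVec_mulVec, ← pow_succ'] at h2
        exact h2.symm
    refine hobs x fun k => ?_
    ext1 i
    rw [← leadCoeffInfty_freeOutput, h1, Pi.zero_apply, map_zero, Pi.zero_apply]
  have hker : LinearMap.ker S.reach = LinearMap.ker (strictOutput S.tfm) := by
    refine le_antisymm S.ker_reach_le fun u hu => ?_
    rw [LinearMap.mem_ker, strictOutput_tfm] at hu
    exact hfree _ hu
  rw [← (Submodule.quotEquivOfEq _ _ hker).finrank_eq, S.reach.quotKerEquivRange.finrank_eq, hS,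
    finrank_top, Module.finrank_fintype_fun_eq_card]

end Reach

/-! ### The Smith form of a polynomial matrix -/

section Smith

/-- `M` and `N` differ by multiplication with unimodular matrices. -/
def UnimodularEquiv {R : Type*} [CommRing R] {p m : ℕ} (M N : Matrix (Fin p) (Fin m) R) : Prop :=
  ∃ (U : (Matrix (Fin p) (Fin p) R)ˣ) (V : (Matrix (Fin m) (Fin m) R)ˣ),
    M = U.val * N * V.val

section CommRing

variable {R : Type*} [CommRing R] {p m : ℕ}

theorem UnimodularEquiv.refl (M : Matrix (Fin p) (Fin m) R) : UnimodularEquiv M M :=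
  ⟨1, 1, by simp⟩

theorem UnimodularEquiv.trans {M N P : Matrix (Fin p) (Fin m) R} (h : UnimodularEquiv M N)
    (h' : UnimodularEquiv N P) : UnimodularEquiv M P := by
  obtain ⟨U, V, rfl⟩ := h
  obtain ⟨U', V', rfl⟩ := h'
  exact ⟨U * U', V' * V, by simp only [Units.val_mul, Matrix.mul_assoc]⟩

theorem UnimodularEquiv.mul_left {M N : Matrix (Fin p) (Fin m) R} (h : UnimodularEquiv M N)
    {U : Matrix (Fin p) (Fin p) R} (hU : IsUnit U) : UnimodularEquiv M (U * N) := by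
  obtain ⟨U, rfl⟩ := hU
  exact h.trans ⟨U⁻¹, 1, by simp [← Matrix.mul_assoc]⟩

theorem UnimodularEquiv.mul_right {M N : Matrix (Fin p) (Fin m) R} (h : UnimodularEquiv M N)
    {V : Matrix (Fin m) (Fin m) R} (hV : IsUnit V) : UnimodularEquiv M (N * V) := by
  obtain ⟨V, rfl⟩ := hV
  exact h.trans ⟨1, V⁻¹, by simp [Matrix.mul_assoc]⟩

theorem UnimodularEquiv.smul {M N : Matrix (Fin p) (Fin m) R} (h : UnimodularEquiv M N) (a : R) :
    UnimodularEquiv (a • M) (a • N) := by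
  obtain ⟨U, V, rfl⟩ := h
  exact ⟨U, V, by rw [Matrix.mul_smul, Matrix.smul_mul]⟩

theorem isUnit_transvection {i j : Fin p} (hij : i ≠ j) (c : R) : IsUnit (transvection i j c) := by
  rw [Matrix.isUnit_iff_isUnit_det, det_transvection_of_ne i j hij]
  exact isUnit_one

theorem UnimodularEquiv.submatrix {M N : Matrix (Fin p) (Fin m) R} (h : UnimodularEquiv M N)
    (σ : Equiv.Perm (Fin p)) (τ : Equiv.Perm (Fin m)) :
    UnimodularEquiv M (N.submatrix σ τ) := by
  have hu {k : ℕ} (ρ : Equiv.Perm (Fin k)) : IsUnit (ρ.permMatrix R) := by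
    rw [Matrix.isUnit_iff_isUnit_det, det_permutation]
    exact (Units.isUnit _).map (Int.castRingHom R)
  have h1 := (h.mul_left (hu σ)).mul_right (hu τ⁻¹)
  rw [Equiv.Perm.permMatrix, Equiv.Perm.permMatrix, PEquiv.toMatrix_toPEquiv_mul,
    PEquiv.mul_toMatrix_toPEquiv, submatrix_submatrix] at h1
  exact h1

/-- The block matrix `[1 0; 0 M]`. -/
def border (M : Matrix (Fin p) (Fin m) R) : Matrix (Fin (p + 1)) (Fin (m + 1)) R :=
  Matrix.of (Fin.cons (Fin.cons 1 0) fun i => Fin.cons 0 (M i))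

theorem border_mul {k : ℕ} (M : Matrix (Fin p) (Fin k) R) (N : Matrix (Fin k) (Fin m) R) :
    border M * border N = border (M * N) := by
  ext i j
  refine Fin.cases ?_ (fun i => ?_) i <;> refine Fin.cases ?_ (fun j => ?_) j <;>
    simp [border, Matrix.mul_apply, Fin.sum_univ_succ]

theorem border_one : border (1 : Matrix (Fin p) (Fin p) R) = 1 := by
  ext i j
  refine Fin.cases ?_ (fun i => ?_) i <;> refine Fin.cases ?_ (fun j => ?_) j <;>
    simp [border, Matrix.one_apply, Fin.succ_ne_zero, (Fin.succ_ne_zero _).symm]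

theorem UnimodularEquiv.border {M N : Matrix (Fin p) (Fin m) R} (h : UnimodularEquiv M N) :
    UnimodularEquiv (border M) (border N) := by
  obtain ⟨U, V, rfl⟩ := h
  have hu {k : ℕ} (W : (Matrix (Fin k) (Fin k) R)ˣ) : IsUnit (SRTR.border W.val) :=
    isUnit_iff_exists.2 ⟨SRTR.border W⁻¹.val, by rw [border_mul, Units.mul_inv, border_one],
      by rw [border_mul, Units.inv_mul, border_one]⟩
  exact ⟨(hu U).unit, (hu V).unit, by simp only [IsUnit.unit_spec, border_mul]⟩

/-- The block matrix `[1 0; c I]`. -/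
def lowerBorder (c : Fin p → R) : Matrix (Fin (p + 1)) (Fin (p + 1)) R :=
  Matrix.of (Fin.cons (Fin.cons 1 0) fun i => Fin.cons (c i) ((1 : Matrix (Fin p) (Fin p) R) i))

theorem lowerBorder_mul_neg (c : Fin p → R) : lowerBorder c * lowerBorder (-c) = 1 := by
  ext i j
  refine Fin.cases ?_ (fun i => ?_) i <;> refine Fin.cases ?_ (fun j => ?_) j <;>
    simp [lowerBorder, Matrix.mul_apply, Fin.sum_univ_succ, Matrix.one_apply, Fin.succ_ne_zero,
      (Fin.succ_ne_zero _).symm]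

theorem isUnit_lowerBorder (c : Fin p → R) : IsUnit (lowerBorder c) :=
  isUnit_iff_exists.2 ⟨lowerBorder (-c), lowerBorder_mul_neg c, by
    simpa using lowerBorder_mul_neg (-c)⟩

theorem isUnit_lowerBorder_transpose (c : Fin p → R) : IsUnit (lowerBorder c)ᵀ := by
  rw [Matrix.isUnit_iff_isUnit_det, det_transpose, ← Matrix.isUnit_iff_isUnit_det]
  exact isUnit_lowerBorder c

/-- The pivot `1` clears its row and column, and the remaining block is the Schur complement. -/
theorem exists_unimodularEquiv_border (N : Matrix (Fin (p + 1)) (Fin (m + 1)) R)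
    (hN : N 0 0 = 1) : ∃ M, UnimodularEquiv N (border M) := by
  refine ⟨Matrix.of fun i j => N i.succ j.succ - N i.succ 0 * N 0 j.succ,
    (isUnit_lowerBorder fun i => N i.succ 0).unit,
    (isUnit_lowerBorder_transpose fun j => N 0 j.succ).unit, ?_⟩
  rw [IsUnit.unit_spec, IsUnit.unit_spec]
  ext i j
  refine Fin.cases ?_ (fun i => ?_) i <;> refine Fin.cases ?_ (fun j => ?_) j <;>
    simp [border, lowerBorder, Matrix.mul_apply, Fin.sum_univ_succ, hN, Matrix.one_apply]

/-- The matrix with `s₁, …, sᵣ` in the first diagonal positions and zeros elsewhere. -/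
def smithDiagonal (p m : ℕ) {r : ℕ} (s : Fin r → R) : Matrix (Fin p) (Fin m) R :=
  Matrix.of fun i j => if h : i.val < r then if j.val = i.val then s ⟨i.val, h⟩ else 0 else 0

theorem smithDiagonal_cons {r : ℕ} (a : R) (s : Fin r → R) :
    smithDiagonal (p + 1) (m + 1) (Fin.cons a fun k => a * s k : Fin (r + 1) → R) =
      a • border (smithDiagonal p m s) := by
  ext i j
  refine Fin.cases ?_ (fun i => ?_) i <;> refine Fin.cases ?_ (fun j => ?_) j
  · simp [smithDiagonal, border]
  · simp [smithDiagonal, border]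
  · simp [smithDiagonal, border]
  · simp only [smithDiagonal, border, Matrix.of_apply, Matrix.smul_apply, Fin.cons_succ,
      Fin.val_succ, add_lt_add_iff_right, add_left_inj, smul_eq_mul]
    by_cases h : i.val < r
    · have : (⟨i.val + 1, by omega⟩ : Fin (r + 1)) = Fin.succ ⟨i.val, h⟩ := rfl
      simp only [h, dif_pos, this, Fin.cons_succ]
      split_ifs <;> simp
    · simp [h]

end CommRing

variable {p m : ℕ}

/-- Choose a nonzero entry of least degree among all entries of all equivalent matrices and move it
to the corner. A nonzero remainder on division by it would be an entry of smaller degree in an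
equivalent matrix. -/
theorem exists_monic_dvd_entries (N : Matrix (Fin (p + 1)) (Fin (m + 1)) ℝ[X]) (hN : N ≠ 0) :
    ∃ M, UnimodularEquiv N M ∧ (M 0 0).Monic ∧ ∀ i j, M 0 0 ∣ M i j := by
  classical
  have hex : ∃ d : ℕ, ∃ M, UnimodularEquiv N M ∧ ∃ i j, M i j ≠ 0 ∧ (M i j).natDegree = d := by
    obtain ⟨i, j, hij⟩ : ∃ i j, N i j ≠ 0 := by
      by_contra! h
      exact hN (Matrix.ext h)
    exact ⟨_, N, .refl N, i, j, hij, rfl⟩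
  obtain ⟨M, hM, i₀, j₀, h0, hd⟩ := Nat.find_spec hex
  have hmin (M' : Matrix (Fin (p + 1)) (Fin (m + 1)) ℝ[X]) (hM' : UnimodularEquiv N M') (i j)
      (hij : M' i j ≠ 0) : Nat.find hex ≤ (M' i j).natDegree :=
    Nat.find_min' hex ⟨M', hM', i, j, hij, rfl⟩
  set d := Nat.find hex
  have hrow (M' : Matrix (Fin (p + 1)) (Fin (m + 1)) ℝ[X]) (hM' : UnimodularEquiv N M')
      (hmon : (M' 0 0).Monic) (hdeg : (M' 0 0).natDegree = d) (j) : M' 0 0 ∣ M' 0 j := by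
    rcases eq_or_ne j 0 with rfl | hj
    · rfl
    rw [← modByMonic_eq_zero_iff_dvd hmon]
    by_contra hne
    have h1 := hmin _ (hM'.mul_right (isUnit_transvection hj.symm (-(M' 0 j /ₘ M' 0 0)))) 0 j
    rw [mul_transvection_apply_same] at h1
    have h2 : M' 0 j + -(M' 0 j /ₘ M' 0 0) * M' 0 0 = M' 0 j %ₘ M' 0 0 := by
      linear_combination -(modByMonic_add_div (M' 0 j) (M' 0 0))
    rw [h2] at h1
    have h3 := natDegree_lt_natDegree hne (degree_modByMonic_lt (M' 0 j) hmon)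
    have h4 := h1 hne
    omega
  have hcol (M' : Matrix (Fin (p + 1)) (Fin (m + 1)) ℝ[X]) (hM' : UnimodularEquiv N M')
      (hmon : (M' 0 0).Monic) (hdeg : (M' 0 0).natDegree = d) (i) : M' 0 0 ∣ M' i 0 := by
    rcases eq_or_ne i 0 with rfl | hi
    · rfl
    rw [← modByMonic_eq_zero_iff_dvd hmon]
    by_contra hne
    have h1 := hmin _ (hM'.mul_left (isUnit_transvection hi (-(M' i 0 /ₘ M' 0 0)))) i 0
    rw [transvection_mul_apply_same] at h1
    have h2 : M' i 0 + -(M' i 0 /ₘ M' 0 0) * M' 0 0 = M' i 0 %ₘ M' 0 0 := by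
      linear_combination -(modByMonic_add_div (M' i 0) (M' 0 0))
    rw [h2] at h1
    have h3 := natDegree_lt_natDegree hne (degree_modByMonic_lt (M' i 0) hmon)
    have h4 := h1 hne
    omega
  let c : ℝ[X] := Polynomial.C (M i₀ j₀).leadingCoeff⁻¹
  have hc : IsUnit (c • (1 : Matrix (Fin (p + 1)) (Fin (p + 1)) ℝ[X])) := by
    rw [Matrix.isUnit_iff_isUnit_det, det_smul, det_one, mul_one]
    exact (isUnit_C.2 (by simpa using h0)).pow _
  let M' := c • (1 : Matrix (Fin (p + 1)) (Fin (p + 1)) ℝ[X]) *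
    M.submatrix (Equiv.swap 0 i₀) (Equiv.swap 0 j₀)
  have hM'00 : M' 0 0 = M i₀ j₀ * c := by
    simp only [M', Matrix.smul_mul, Matrix.one_mul, Matrix.smul_apply, submatrix_apply,
      Equiv.swap_apply_left, smul_eq_mul]
    rw [mul_comm]
  have hE : UnimodularEquiv N M' := (hM.submatrix _ _).mul_left hc
  have hmon : (M' 0 0).Monic := by rw [hM'00]; exact monic_mul_leadingCoeff_inv h0
  have hdeg : (M' 0 0).natDegree = d := by
    rw [hM'00, natDegree_mul_leadingCoeff_inv _ h0, hd]
  refine ⟨M', hE, hmon, fun i j => ?_⟩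
  rcases eq_or_ne i 0 with rfl | hi
  · exact hrow M' hE hmon hdeg j
  obtain ⟨q, hq⟩ := hcol M' hE hmon hdeg i
  -- For an entry outside the first row and column: clear the entry `(i, 0)`, then add row `i` to
  -- row `0`. The corner is unchanged, so its divisibility along the first row now reaches row `i`.
  let P := transvection i 0 (-q) * M'
  let Q := transvection 0 i (1 : ℝ[X]) * P
  have hP0 (k) : P 0 k = M' 0 k := transvection_mul_apply_of_ne _ _ _ _ hi.symm _ _
  have hPi (k) : P i k = M' i k + -q * M' 0 k := transvection_mul_apply_same _ _ _ _ _
  have hQ0 (k) : Q 0 k = M' 0 k + (M' i k + -q * M' 0 k) := by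
    rw [← hPi, ← hP0, ← one_mul (P i k)]
    exact transvection_mul_apply_same _ _ _ _ _
  have hQ00 : Q 0 0 = M' 0 0 := by rw [hQ0, hq]; ring
  have hQE : UnimodularEquiv N Q :=
    (hE.mul_left (isUnit_transvection hi _)).mul_left (isUnit_transvection hi.symm _)
  have h1 := hrow Q hQE (by rwa [hQ00]) (by rwa [hQ00]) j
  have h2 := hrow M' hE hmon hdeg j
  rw [hQ00, hQ0] at h1
  have h3 := (dvd_add_right h2).1 h1
  exact (dvd_add_left (h2.mul_left (-q))).1 h3

/-- Every real polynomial matrix has a Smith form. -/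
theorem exists_smithForm (N : Matrix (Fin p) (Fin m) ℝ[X]) :
    ∃ (r : ℕ) (s : Fin r → ℝ[X]), r ≤ p ∧ r ≤ m ∧ (∀ k, (s k).Monic) ∧
      (∀ k l, k ≤ l → s k ∣ s l) ∧ UnimodularEquiv N (smithDiagonal p m s) := by
  induction p generalizing m with
  | zero =>
    refine ⟨0, Fin.elim0, le_rfl, Nat.zero_le _, fun k => k.elim0, fun k => k.elim0, ?_⟩
    rw [Subsingleton.elim N (smithDiagonal 0 m Fin.elim0)]
    exact .refl _
  | succ p ih =>
    by_cases hN : N = 0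
    · refine ⟨0, Fin.elim0, Nat.zero_le _, Nat.zero_le _, fun k => k.elim0, fun k => k.elim0, ?_⟩
      have : smithDiagonal (p + 1) m (Fin.elim0 : Fin 0 → ℝ[X]) = N := by
        ext1 i j; simp [smithDiagonal, hN]
      rw [this]
      exact .refl _
    cases m with
    | zero => exact absurd (Matrix.ext fun i j => j.elim0) hN
    | succ m =>
      obtain ⟨M, hM, hmon, hdvd⟩ := exists_monic_dvd_entries N hN
      choose Q hQ using hdvd
      -- Factoring the corner out of the whole matrix leaves a pivot `1`, and all later invariant
      -- factors acquire it as a factor.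
      have hMQ : M = M 0 0 • Matrix.of Q := by
        ext1 i j
        rw [Matrix.smul_apply, smul_eq_mul, Matrix.of_apply, ← hQ]
      have hQ0 : (Matrix.of Q) 0 0 = 1 :=
        mul_left_cancel₀ hmon.ne_zero ((hQ 0 0).symm.trans (mul_one _).symm)
      obtain ⟨L, hL⟩ := exists_unimodularEquiv_border _ hQ0
      obtain ⟨r, s, hrp, hrm, hs, hsd, hE⟩ := ih L
      refine ⟨r + 1, Fin.cons (M 0 0) fun k => M 0 0 * s k, by omega, by omega, ?_, ?_, ?_⟩
      · intro k
        refine Fin.cases ?_ (fun k => ?_) k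
        · simpa using hmon
        · simpa using hmon.mul (hs k)
      · intro k l
        refine Fin.cases ?_ (fun k => ?_) k <;> refine Fin.cases ?_ (fun l => ?_) l
        · simp
        · simp
        · intro h; exact absurd h (by simp)
        · intro h
          simpa using mul_dvd_mul_left (M 0 0) (hsd k l (by simpa using h))
      · rw [smithDiagonal_cons]
        refine hM.trans ?_
        rw [hMQ]
        convert (hL.trans hE.border).smul (M 0 0) using 2
        rw [Matrix.smul_apply, hQ0, smul_eq_mul, mul_one]

end Smith

/-! ### The Smith-McMillan form -/

section SmithMcMillan

variable {p m : ℕ}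

theorem exists_coprime_fraction {s χ : ℝ[X]} (hs : s.Monic) (hχ : χ.Monic) :
    ∃ ε ψ : ℝ[X], ε.Monic ∧ ψ.Monic ∧ IsCoprime ε ψ ∧ ε * χ = s * ψ := by
  let f : RatFunc ℝ := algebraMap ℝ[X] (RatFunc ℝ) s / algebraMap ℝ[X] (RatFunc ℝ) χ
  have h : f.num * χ = s * f.denom := (RatFunc.num_mul_eq_mul_denom_iff hχ.ne_zero).2 rfl
  refine ⟨f.num, f.denom, ?_, f.monic_denom, f.isCoprime_num_denom, h⟩
  have h1 := congrArg leadingCoeff h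
  rwa [leadingCoeff_mul, leadingCoeff_mul, hs, hχ, f.monic_denom, mul_one, mul_one] at h1

theorem exists_monic_common_multiple {ι : Type*} [Fintype ι] (d : ι → ℝ[X])
    (hd : ∀ i, (d i).Monic) : ∃ χ : ℝ[X], χ.Monic ∧ ∀ i, d i ∣ χ :=
  ⟨∏ i, d i, monic_prod_of_monic _ _ fun i _ => hd i,
    fun i => Finset.dvd_prod_of_mem d (Finset.mem_univ i)⟩

theorem exists_common_denominator (G : TFM (Fin p) (Fin m)) :
    ∃ (χ : ℝ[X]) (N : Matrix (Fin p) (Fin m) ℝ[X]), χ.Monic ∧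
      ∀ i j, G i j * algebraMap ℝ[X] (RatFunc ℝ) χ = algebraMap ℝ[X] (RatFunc ℝ) (N i j) := by
  obtain ⟨χ, hχ, hdvd⟩ := exists_monic_common_multiple
    (fun k : Fin p × Fin m => (G k.1 k.2).denom) fun k => RatFunc.monic_denom _
  replace hdvd (i j) : (G i j).denom ∣ χ := hdvd (i, j)
  choose Q hQ using hdvd
  refine ⟨χ, Matrix.of fun i j => (G i j).num * Q i j, hχ, fun i j => ?_⟩
  have hd : algebraMap ℝ[X] (RatFunc ℝ) (G i j).denom ≠ 0 := by
    simpa using (G i j).denom_ne_zero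
  rw [Matrix.of_apply, hQ i j, map_mul, map_mul, ← mul_assoc]
  nth_rw 1 [← RatFunc.num_div_denom (G i j)]
  rw [div_mul_cancel₀ _ hd]

/-- Divide the Smith form of the polynomial matrix `χG` by `χ` and reduce the fractions. -/
theorem exists_isSmithMcMillanForm (G : TFM (Fin p) (Fin m)) :
    ∃ (r : ℕ) (ε ψ : Fin r → ℝ[X]), IsSmithMcMillanForm G ε ψ := by
  obtain ⟨χ, N, hχ, hN⟩ := exists_common_denominator G
  obtain ⟨r, s, hrp, hrm, hs, hsd, U, V, hUV⟩ := exists_smithForm N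
  choose ε ψ hε hψ hco hfrac using fun k => exists_coprime_fraction (hs k) hχ
  -- Cross-multiplied form of `εₗ/ψₗ = t εₖ/ψₖ`; coprimality extracts both divisibility chains from
  -- it.
  have hcross (k l) (hkl : k ≤ l) : ∃ t, ε l * ψ k = t * ε k * ψ l := by
    obtain ⟨t, ht⟩ := hsd k l hkl
    refine ⟨t, mul_right_cancel₀ hχ.ne_zero ?_⟩
    linear_combination ψ k * hfrac l + ψ k * ψ l * ht - t * ψ l * hfrac k
  refine ⟨r, ε, ψ, hrp, hrm, hε, hψ, hco, fun k l hkl => ?_, fun k l hkl => ?_, ?_⟩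
  · obtain ⟨t, ht⟩ := hcross k l hkl
    exact (hco k).dvd_of_dvd_mul_right ⟨t * ψ l, by rw [ht]; ring⟩
  · obtain ⟨t, ht⟩ := hcross k l hkl
    exact (hco l).symm.dvd_of_dvd_mul_left ⟨t * ε k, by rw [ht]; ring⟩
  refine ⟨U.val, V.val, (Matrix.isUnit_iff_isUnit_det _).1 U.isUnit,
    (Matrix.isUnit_iff_isUnit_det _).1 V.isUnit, ?_⟩
  have hχ0 : algebraMap ℝ[X] (RatFunc ℝ) χ ≠ 0 := by simpa using hχ.ne_zero
  have h1 : (smithDiagonal p m s).map (algebraMap ℝ[X] (RatFunc ℝ)) =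
      algebraMap ℝ[X] (RatFunc ℝ) χ • smithMcMillanDiagonal p m ε ψ := by
    ext1 i j
    simp only [smithDiagonal, smithMcMillanDiagonal, Matrix.map_apply, Matrix.of_apply,
      Matrix.smul_apply, smul_eq_mul]
    split_ifs with h
    · have hψ0 : algebraMap ℝ[X] (RatFunc ℝ) (ψ ⟨i, h⟩) ≠ 0 := by simpa using (hψ _).ne_zero
      rw [mul_div_assoc', eq_div_iff hψ0, ← map_mul, ← map_mul, ← hfrac, mul_comm]
    · simp
    · simp
  have h2 : algebraMap ℝ[X] (RatFunc ℝ) χ • G = N.map (algebraMap ℝ[X] (RatFunc ℝ)) := by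
    ext1 i j
    rw [Matrix.smul_apply, smul_eq_mul, Matrix.map_apply, ← hN, mul_comm]
  rw [hUV, Matrix.map_mul, Matrix.map_mul, h1, Matrix.mul_smul, Matrix.smul_mul] at h2
  exact smul_right_injective _ hχ0 h2

end SmithMcMillan

/-! ### The McMillan degree of a proper TFM as the dimension of the response module -/

section PoleDegree

variable {p m : ℕ}

theorem mem_ker_strictOutput_iff_mulVec {G : TFM (Fin p) (Fin m)} {u : Fin m → ℝ[X]} :
    u ∈ LinearMap.ker (strictOutput G) ↔ ∃ P : Fin p → ℝ[X],
      G *ᵥ (algebraMap ℝ[X] (RatFunc ℝ) ∘ u) = algebraMap ℝ[X] (RatFunc ℝ) ∘ P := by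
  simp only [mem_ker_strictOutput, funext_iff, Matrix.mulVec, dotProduct, Function.comp_apply]

theorem map_algebraMap_mulVec {k l : Type*} [Fintype l] (M : Matrix k l ℝ[X]) (u : l → ℝ[X]) :
    M.map (algebraMap ℝ[X] (RatFunc ℝ)) *ᵥ (algebraMap ℝ[X] (RatFunc ℝ) ∘ u) =
      algebraMap ℝ[X] (RatFunc ℝ) ∘ (M *ᵥ u) := by
  ext1 i
  exact (RingHom.map_mulVec _ M u i).symm

theorem map_algebraMap_nonsing_inv {k : ℕ} {U : Matrix (Fin k) (Fin k) ℝ[X]} (hU : IsUnit U.det) :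
    U⁻¹.map (algebraMap ℝ[X] (RatFunc ℝ)) * U.map (algebraMap ℝ[X] (RatFunc ℝ)) = 1 ∧
      U.map (algebraMap ℝ[X] (RatFunc ℝ)) * U⁻¹.map (algebraMap ℝ[X] (RatFunc ℝ)) = 1 := by
  rw [← Matrix.map_mul, ← Matrix.map_mul, nonsing_inv_mul _ hU, mul_nonsing_inv _ hU,
    Matrix.map_one _ (map_zero _) (map_one _)]
  exact ⟨rfl, rfl⟩

theorem smithMcMillanDiagonal_apply {r : ℕ} (ε ψ : Fin r → ℝ[X]) (k : Fin r) (hp : r ≤ p)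
    (hm : r ≤ m) : smithMcMillanDiagonal p m ε ψ (Fin.castLE hp k) (Fin.castLE hm k) =
      algebraMap ℝ[X] (RatFunc ℝ) (ε k) / algebraMap ℝ[X] (RatFunc ℝ) (ψ k) := by
  simp [smithMcMillanDiagonal]

theorem smithMcMillanDiagonal_mulVec {r : ℕ} (ε ψ : Fin r → ℝ[X]) (hm : r ≤ m)
    (x : Fin m → RatFunc ℝ) (i : Fin p) : (smithMcMillanDiagonal p m ε ψ *ᵥ x) i =
      if h : i.val < r then algebraMap ℝ[X] (RatFunc ℝ) (ε ⟨i, h⟩) /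
        algebraMap ℝ[X] (RatFunc ℝ) (ψ ⟨i, h⟩) * x ⟨i, h.trans_le hm⟩ else 0 := by
  rw [Matrix.mulVec, dotProduct]
  by_cases h : i.val < r
  · rw [dif_pos h, Finset.sum_eq_single ⟨i, h.trans_le hm⟩]
    · simp [smithMcMillanDiagonal, h]
    · intro j _ hj
      have : j.val ≠ i.val := fun hji => hj (Fin.ext hji)
      simp [smithMcMillanDiagonal, h, this]
    · simp
  · rw [dif_neg h]
    refine Finset.sum_eq_zero fun j _ => ?_
    simp [smithMcMillanDiagonal, h]

/-- The denominators of the Smith-McMillan form, continued by `1`. -/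
def extendByOne (m : ℕ) {r : ℕ} (ψ : Fin r → ℝ[X]) (j : Fin m) : ℝ[X] :=
  if h : j.val < r then ψ ⟨j, h⟩ else 1

/-- Coprimality gives `ψ ∣ εw ↔ ψ ∣ w`. Coordinates beyond the rank do not affect the product, hence
the divisor `1` there. -/
theorem exists_smithMcMillanDiagonal_mulVec_eq {r : ℕ} {ε ψ : Fin r → ℝ[X]} (hp : r ≤ p)
    (hm : r ≤ m) (hψ : ∀ k, (ψ k).Monic) (hco : ∀ k, IsCoprime (ε k) (ψ k)) (w : Fin m → ℝ[X]) :
    (∃ P : Fin p → ℝ[X], smithMcMillanDiagonal p m ε ψ *ᵥ (algebraMap ℝ[X] (RatFunc ℝ) ∘ w) =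
      algebraMap ℝ[X] (RatFunc ℝ) ∘ P) ↔ ∀ j, extendByOne m ψ j ∣ w j := by
  have hψ0 (k) : algebraMap ℝ[X] (RatFunc ℝ) (ψ k) ≠ 0 := by simpa using (hψ k).ne_zero
  constructor
  · rintro ⟨P, hP⟩ j
    rw [extendByOne]
    split_ifs with h
    · have h1 := congrFun hP ⟨j, h.trans_le hp⟩
      rw [smithMcMillanDiagonal_mulVec _ _ hm, dif_pos h, div_mul_eq_mul_div, div_eq_iff (hψ0 _),
        Function.comp_apply, Function.comp_apply, ← map_mul, ← map_mul] at h1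
      have h2 := IsFractionRing.injective ℝ[X] (RatFunc ℝ) h1
      exact (hco ⟨j, h⟩).symm.dvd_of_dvd_mul_left ⟨_, h2.trans (mul_comm _ _)⟩
    · exact one_dvd _
  · intro hw
    choose Q hQ using hw
    refine ⟨fun i => if h : i.val < r then ε ⟨i, h⟩ * Q ⟨i, h.trans_le hm⟩ else 0, ?_⟩
    ext1 i
    rw [smithMcMillanDiagonal_mulVec _ _ hm, Function.comp_apply]
    split_ifs with h
    · rw [Function.comp_apply, hQ, extendByOne, dif_pos h, map_mul, map_mul,
        ← mul_assoc, div_mul_cancel₀ _ (hψ0 _)]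
    · rw [map_zero]

theorem IsSmithMcMillanForm.mem_ker_strictOutput {G : TFM (Fin p) (Fin m)} {r : ℕ}
    {ε ψ : Fin r → ℝ[X]} {U : Matrix (Fin p) (Fin p) ℝ[X]} {V : Matrix (Fin m) (Fin m) ℝ[X]}
    (hG : IsSmithMcMillanForm G ε ψ) (hU : IsUnit U.det)
    (hUV : G = U.map (algebraMap ℝ[X] (RatFunc ℝ)) * smithMcMillanDiagonal p m ε ψ *
      V.map (algebraMap ℝ[X] (RatFunc ℝ))) (u : Fin m → ℝ[X]) :
    u ∈ LinearMap.ker (strictOutput G) ↔ ∀ j, extendByOne m ψ j ∣ (V *ᵥ u) j := by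
  rw [mem_ker_strictOutput_iff_mulVec, ← exists_smithMcMillanDiagonal_mulVec_eq hG.le_rows
    hG.le_cols hG.monic_den hG.coprime, hUV]
  simp only [← Matrix.mulVec_mulVec, map_algebraMap_mulVec]
  constructor
  · rintro ⟨P, hP⟩
    refine ⟨U⁻¹ *ᵥ P, ?_⟩
    rw [← map_algebraMap_mulVec U⁻¹ P, ← hP, Matrix.mulVec_mulVec,
      (map_algebraMap_nonsing_inv hU).1, Matrix.one_mulVec]
  · rintro ⟨P, hP⟩
    exact ⟨U *ᵥ P, by rw [← map_algebraMap_mulVec U P, hP]⟩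

theorem sum_natDegree_extendByOne {r : ℕ} (ψ : Fin r → ℝ[X]) (hm : r ≤ m) :
    ∑ j, (extendByOne m ψ j).natDegree = ∑ k, (ψ k).natDegree := by
  symm
  refine Finset.sum_of_injOn (Fin.castLE hm) (Fin.castLE_injective hm).injOn (by simp) ?_ ?_
  · intro j _ hj
    have : ¬ j.val < r := fun h => hj ⟨⟨j, h⟩, by simp, rfl⟩
    simp [extendByOne, this]
  · intro k _
    simp [extendByOne]

/-- The response module is the product of the modules `ℝ[λ]/(ψₖ)`. -/
def IsSmithMcMillanForm.responseModuleEquiv {G : TFM (Fin p) (Fin m)} {r : ℕ}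
    {ε ψ : Fin r → ℝ[X]} {U : Matrix (Fin p) (Fin p) ℝ[X]} {V : Matrix (Fin m) (Fin m) ℝ[X]}
    (hG : IsSmithMcMillanForm G ε ψ) (hU : IsUnit U.det) (hV : IsUnit V.det)
    (hUV : G = U.map (algebraMap ℝ[X] (RatFunc ℝ)) * smithMcMillanDiagonal p m ε ψ *
      V.map (algebraMap ℝ[X] (RatFunc ℝ))) :
    ResponseModule G ≃ₗ[ℝ] ((j : Fin m) → ℝ[X] ⧸ Ideal.span {extendByOne m ψ j}) :=
  have : Invertible V := V.invertibleOfIsUnitDet hV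
  let e : (Fin m → ℝ[X]) ≃ₗ[ℝ] (Fin m → ℝ[X]) :=
    (Matrix.toLinearEquiv' V this).restrictScalars ℝ
  Submodule.Quotient.equiv _ (Submodule.pi Set.univ fun j =>
      (Ideal.span {extendByOne m ψ j}).restrictScalars ℝ) e (by
    ext w
    rw [Submodule.mem_map_equiv, hG.mem_ker_strictOutput hU hUV]
    have h : V *ᵥ (e.symm w) = w := e.apply_symm_apply w
    simp [h, Submodule.mem_pi, Ideal.mem_span_singleton]) ≪≫ₗ
  Submodule.quotientPi _ ≪≫ₗ
  LinearEquiv.piCongrRight fun j => Submodule.Quotient.restrictScalarsEquiv ℝ _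

theorem IsSmithMcMillanForm.finiteDimensional_and_finrank {G : TFM (Fin p) (Fin m)} {r : ℕ}
    {ε ψ : Fin r → ℝ[X]} (hG : IsSmithMcMillanForm G ε ψ) :
    FiniteDimensional ℝ (ResponseModule G) ∧
      Module.finrank ℝ (ResponseModule G) = ∑ k, (ψ k).natDegree := by
  obtain ⟨U, V, hU, hV, hUV⟩ := hG.factorization
  let e := hG.responseModuleEquiv hU hV hUV
  have hmon (j : Fin m) : (extendByOne m ψ j).Monic := by
    rw [extendByOne]
    split_ifs
    · exact hG.monic_den _
    · exact monic_one
  have hfin (j : Fin m) : Module.Finite ℝ (ℝ[X] ⧸ Ideal.span {extendByOne m ψ j}) :=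
    (hmon j).finite_quotient
  refine ⟨Module.Finite.equiv e.symm, ?_⟩
  rw [e.finrank_eq, Module.finrank_pi_fintype, ← sum_natDegree_extendByOne ψ hG.le_cols]
  exact Finset.sum_congr rfl fun j _ => finrank_quotient_span_eq_natDegree

/-- The dimension counts the finite poles only, and the poles at infinity can only increase `δ`. -/
theorem HasMcMillanDegree.finiteDimensional_and_finrank_le {G : TFM (Fin p) (Fin m)} {δ : ℕ}
    (hG : HasMcMillanDegree G δ) : FiniteDimensional ℝ (ResponseModule G) ∧
      Module.finrank ℝ (ResponseModule G) ≤ δ := by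
  obtain ⟨d, e, ⟨r, ε, ψ, h, rfl⟩, -, rfl⟩ := hG
  obtain ⟨h1, h2⟩ := h.finiteDimensional_and_finrank
  exact ⟨h1, by omega⟩

/-- The rational functions without a pole at `0`. -/
def regularAtZero : Subring (RatFunc ℝ) where
  carrier := {f | ∃ a b : ℝ[X], b.eval 0 ≠ 0 ∧
    f * algebraMap ℝ[X] (RatFunc ℝ) b = algebraMap ℝ[X] (RatFunc ℝ) a}
  mul_mem' := by
    rintro f g ⟨a, b, hb, h⟩ ⟨c, d, hd, h'⟩
    refine ⟨a * c, b * d, by simp [hb, hd], ?_⟩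
    rw [map_mul, map_mul, ← h, ← h']; ring
  one_mem' := ⟨1, 1, by simp, by simp⟩
  add_mem' := by
    rintro f g ⟨a, b, hb, h⟩ ⟨c, d, hd, h'⟩
    refine ⟨a * d + c * b, b * d, by simp [hb, hd], ?_⟩
    rw [map_add, map_mul, map_mul, map_mul, ← h, ← h']; ring
  zero_mem' := ⟨0, 1, by simp, by simp⟩
  neg_mem' := by
    rintro f ⟨a, b, hb, h⟩
    exact ⟨-a, b, hb, by rw [map_neg, ← h]; ring⟩

theorem algebraMap_mem_regularAtZero (P : ℝ[X]) :
    algebraMap ℝ[X] (RatFunc ℝ) P ∈ regularAtZero := ⟨P, 1, by simp, by simp⟩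

/-- With `N` the degree of the denominator, `f(1/λ)` is the quotient of the two polynomials reversed
at `N`. The reversed denominator takes at `0` the leading coefficient of the original one. -/
theorem eval_X_inv_mem_regularAtZero {f : RatFunc ℝ}
    (hf : f.num.natDegree ≤ f.denom.natDegree) :
    RatFunc.eval RatFunc.C (RatFunc.X : RatFunc ℝ)⁻¹ f ∈ regularAtZero := by
  let N := f.denom.natDegree
  have hX : (RatFunc.X : RatFunc ℝ)⁻¹ ≠ 0 := inv_ne_zero RatFunc.X_ne_zero
  have key (P : ℝ[X]) (hP : P.natDegree ≤ N) : P.eval₂ RatFunc.C (RatFunc.X : RatFunc ℝ)⁻¹ =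
      algebraMap ℝ[X] (RatFunc ℝ) (reflect N P) * (RatFunc.X : RatFunc ℝ)⁻¹ ^ N := by
    have := invertibleOfNonzero hX
    rw [← eval₂_reflect_mul_pow _ _ N P hP, invOf_eq_inv, inv_inv,
      ← RatFunc.aeval_X_left_eq_algebraMap, aeval_def, RatFunc.algebraMap_eq_C]
  have h0 : (reflect N f.denom).eval 0 ≠ 0 := by
    rw [← coeff_zero_eq_eval_zero, coeff_reflect, revAt_le (Nat.zero_le _), Nat.sub_zero]
    simpa [N] using f.denom_ne_zero
  refine ⟨reflect N f.num, reflect N f.denom, h0, ?_⟩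
  have h1 : algebraMap ℝ[X] (RatFunc ℝ) (reflect N f.denom) ≠ 0 := by
    rw [Ne, FaithfulSMul.algebraMap_eq_zero_iff]
    rintro h
    rw [h, eval_zero] at h0
    exact h0 rfl
  rw [RatFunc.eval, key _ hf, key _ le_rfl, mul_div_mul_right _ _ (pow_ne_zero _ hX),
    div_mul_cancel₀ _ h1]

/-- Unimodular factors have polynomial inverses, so each `εₖ/ψₖ` is regular at `0` along with `G`;
as the fraction is reduced, `ψₖ` cannot vanish there. -/
theorem IsSmithMcMillanForm.eval_zero_ne_zero {G : TFM (Fin p) (Fin m)} {r : ℕ}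
    {ε ψ : Fin r → ℝ[X]} (hG : IsSmithMcMillanForm G ε ψ) (hreg : ∀ i j, G i j ∈ regularAtZero)
    (k : Fin r) : (ψ k).eval 0 ≠ 0 := by
  obtain ⟨U, V, hU, hV, hUV⟩ := hG.factorization
  have hdiag : smithMcMillanDiagonal p m ε ψ = U⁻¹.map (algebraMap ℝ[X] (RatFunc ℝ)) * G *
      V⁻¹.map (algebraMap ℝ[X] (RatFunc ℝ)) := by
    simp only [hUV, Matrix.mul_assoc]
    rw [(map_algebraMap_nonsing_inv hV).2, Matrix.mul_one, ← Matrix.mul_assoc,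
      (map_algebraMap_nonsing_inv hU).1, Matrix.one_mul]
  have hmem : smithMcMillanDiagonal p m ε ψ (Fin.castLE hG.le_rows k) (Fin.castLE hG.le_cols k) ∈
      regularAtZero := by
    rw [hdiag, Matrix.mul_apply]
    refine Subring.sum_mem _ fun j _ => Subring.mul_mem _ ?_ (algebraMap_mem_regularAtZero _)
    rw [Matrix.mul_apply]
    exact Subring.sum_mem _ fun i _ => Subring.mul_mem _ (algebraMap_mem_regularAtZero _) (hreg i j)
  rw [smithMcMillanDiagonal_apply] at hmem
  obtain ⟨a, b, hb, h⟩ := hmem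
  have hψ0 : algebraMap ℝ[X] (RatFunc ℝ) (ψ k) ≠ 0 := by simpa using (hG.monic_den k).ne_zero
  rw [div_mul_eq_mul_div, div_eq_iff hψ0, ← map_mul, ← map_mul] at h
  have h2 := IsFractionRing.injective ℝ[X] (RatFunc ℝ) h
  obtain ⟨c, rfl⟩ := (hG.coprime k).symm.dvd_of_dvd_mul_left ⟨a, h2.trans (mul_comm _ _)⟩
  intro h0
  exact hb (by rw [eval_mul, h0, zero_mul])

theorem IsProper.hasMcMillanDegree {G : TFM (Fin p) (Fin m)} (hG : IsProper G) :
    HasMcMillanDegree G (Module.finrank ℝ (ResponseModule G)) := by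
  obtain ⟨r, ε, ψ, h⟩ := exists_isSmithMcMillanForm G
  obtain ⟨r', ε', ψ', h'⟩ := exists_isSmithMcMillanForm (atInv G)
  refine ⟨_, 0, ⟨r, ε, ψ, h, h.finiteDimensional_and_finrank.2⟩, ⟨r', ε', ψ', h', ?_⟩, rfl⟩
  refine (Finset.sum_eq_zero fun k _ => rootMultiplicity_eq_zero ?_).symm
  exact h'.eval_zero_ne_zero (fun i j => eval_X_inv_mem_regularAtZero (hG i j)) k

end PoleDegree

/-! ### System response-type realizations of networks -/

/-- Intertwining suffices: `T(λI - A)⁻¹ = (λI - A')⁻¹T`, with no inverse of `T`. -/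
theorem StateSpace.tfm_eq_of_similarity {n m p : Type*} [Fintype n] [DecidableEq n]
    {S S' : StateSpace n m p} {T : Matrix n n ℝ} (hA : S'.A * T = T * S.A) (hB : T * S.B = S'.B)
    (hC : S'.C * T = S.C) (hD : S'.D = S.D) : S'.tfm = S.tfm := by
  have hT : T.map RatFunc.C * resolvent S.A = resolvent S'.A * T.map RatFunc.C := by
    apply eq_resolvent_mul
    have h : ((RatFunc.X : RatFunc ℝ) • (1 : TFM n n) - S'.A.map RatFunc.C) * T.map RatFunc.C =
        T.map RatFunc.C * ((RatFunc.X : RatFunc ℝ) • (1 : TFM n n) - S.A.map RatFunc.C) := by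
      rw [Matrix.sub_mul, Matrix.mul_sub, ← Matrix.map_mul, hA, Matrix.map_mul, Matrix.smul_mul,
        Matrix.mul_smul, Matrix.one_mul, Matrix.mul_one]
    rw [← Matrix.mul_assoc, h, Matrix.mul_assoc, X_sub_mul_resolvent, Matrix.mul_one]
  rw [S'.tfm_eq_resolvent, S.tfm_eq_resolvent, hD, ← hB, ← hC, Matrix.map_mul, Matrix.map_mul]
  congr 1
  simp only [Matrix.mul_assoc]
  rw [← Matrix.mul_assoc (resolvent S'.A), ← hT, Matrix.mul_assoc]

theorem IsSRTRPair.of_tfm_eq {p q m : ℕ} {S S' : StateSpace (Fin p ⊕ Fin q) (Fin m) (Fin p)}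
    {W : TFM (Fin p) (Fin p)} {V : TFM (Fin p) (Fin m)} (h : IsSRTRPair S W V)
    (hS : S'.tfm = S.tfm) : IsSRTRPair S' W V :=
  ⟨h.proper_W, h.proper_V, h.degree_le, h.isUnit_det, hS.trans h.tfm_eq⟩

section Network

variable {p q m : ℕ} (A₁₁ : Matrix (Fin p) (Fin p) ℝ) (A₁₂ : Matrix (Fin p) (Fin q) ℝ)
  (A₂₁ : Matrix (Fin q) (Fin p) ℝ) (A₂₂ : Matrix (Fin q) (Fin q) ℝ)
  (B₁ : Matrix (Fin p) (Fin m) ℝ) (B₂ : Matrix (Fin q) (Fin m) ℝ)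

/-- The system with the state `x` of a network with the state `(y, x)`, driven by `(y, u)`. -/
def subsystem : StateSpace (Fin q) (Fin p ⊕ Fin m) (Fin p) :=
  ⟨A₂₂, Matrix.fromCols A₂₁ B₂, A₁₂, Matrix.fromCols A₁₁ B₁⟩

theorem network_tfm : (network A₁₁ A₁₂ A₂₁ A₂₂ B₁ B₂).tfm =
    (Matrix.fromCols 1 0 : Matrix (Fin p) (Fin p ⊕ Fin q) ℝ).map RatFunc.C *
      resolvent (Matrix.fromBlocks A₁₁ A₁₂ A₂₁ A₂₂) *
      (Matrix.fromRows B₁ B₂).map RatFunc.C := by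
  rw [StateSpace.tfm_eq_resolvent]
  simp only [network, Matrix.map_zero _ (map_zero RatFunc.C), zero_add]

variable {A₁₁ A₁₂ A₂₁ A₂₂ B₁ B₂}

theorem eq_of_fromCols_eq_subsystem_tfm {W : TFM (Fin p) (Fin p)} {V : TFM (Fin p) (Fin m)}
    (h : Matrix.fromCols W V = (subsystem A₁₁ A₁₂ A₂₁ A₂₂ B₁ B₂).tfm) :
    W = A₁₁.map RatFunc.C + A₁₂.map RatFunc.C * resolvent A₂₂ * A₂₁.map RatFunc.C ∧
      V = B₁.map RatFunc.C + A₁₂.map RatFunc.C * resolvent A₂₂ * B₂.map RatFunc.C := by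
  rw [StateSpace.tfm_eq_resolvent] at h
  constructor
  · ext i j
    exact congrFun (congrFun h i) (Sum.inl j)
  · ext i j
    exact congrFun (congrFun h i) (Sum.inr j)

/-- Block elimination: multiplying `λI - A` on the left by `[I A₁₂(λI - A₂₂)⁻¹]` annihilates the
second block column and leaves the Schur complement `λI - W` in the first. -/
theorem X_sub_mul_resolvent_fromBlocks {W : TFM (Fin p) (Fin p)} {V : TFM (Fin p) (Fin m)}
    (h : Matrix.fromCols W V = (subsystem A₁₁ A₁₂ A₂₁ A₂₂ B₁ B₂).tfm) :
    ((RatFunc.X : RatFunc ℝ) • (1 : TFM (Fin p) (Fin p)) - W) *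
        ((Matrix.fromCols 1 0 : Matrix (Fin p) (Fin p ⊕ Fin q) ℝ).map RatFunc.C *
          resolvent (Matrix.fromBlocks A₁₁ A₁₂ A₂₁ A₂₂)) =
      Matrix.fromCols 1 (A₁₂.map RatFunc.C * resolvent A₂₂) := by
  rw [← Matrix.mul_assoc]
  symm
  apply eq_mul_resolvent
  have hX : (RatFunc.X : RatFunc ℝ) • (1 : TFM (Fin p ⊕ Fin q) (Fin p ⊕ Fin q)) -
      (Matrix.fromBlocks A₁₁ A₁₂ A₂₁ A₂₂).map RatFunc.C =
      Matrix.fromBlocks ((RatFunc.X : RatFunc ℝ) • 1 - A₁₁.map RatFunc.C) (-A₁₂.map RatFunc.C)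
        (-A₂₁.map RatFunc.C) ((RatFunc.X : RatFunc ℝ) • 1 - A₂₂.map RatFunc.C) := by
    rw [← Matrix.fromBlocks_one, Matrix.fromBlocks_smul, Matrix.fromBlocks_map, sub_eq_add_neg,
      Matrix.fromBlocks_neg, Matrix.fromBlocks_add]
    simp [sub_eq_add_neg]
  have hC : (Matrix.fromCols 1 0 : Matrix (Fin p) (Fin p ⊕ Fin q) ℝ).map RatFunc.C =
      (Matrix.fromCols 1 0 : TFM (Fin p) (Fin p ⊕ Fin q)) := by
    ext i j
    rcases j with j | j
    · by_cases hij : i = j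
      · subst hij; simp
      · simp [hij]
    · simp
  rw [hX, hC, Matrix.fromCols_mul_fromBlocks, Matrix.mul_fromCols,
    Matrix.mul_assoc _ (resolvent A₂₂) (_ - _), resolvent_mul_X_sub,
    (eq_of_fromCols_eq_subsystem_tfm h).1]
  congr 1
  · simp only [Matrix.one_mul, Matrix.mul_one, Matrix.mul_neg]
    abel
  · simp

/-- The right factor is free: the input matrix `B` yields `(λI - W)G = V`, and `[I; 0]` yields a
right inverse of `λI - W`. -/
theorem X_sub_mul_resolvent_mul {W : TFM (Fin p) (Fin p)} {V : TFM (Fin p) (Fin m)}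
    (h : Matrix.fromCols W V = (subsystem A₁₁ A₁₂ A₂₁ A₂₂ B₁ B₂).tfm) {l : Type*}
    (R₁ : Matrix (Fin p) l ℝ) (R₂ : Matrix (Fin q) l ℝ) :
    ((RatFunc.X : RatFunc ℝ) • (1 : TFM (Fin p) (Fin p)) - W) *
        ((Matrix.fromCols 1 0 : Matrix (Fin p) (Fin p ⊕ Fin q) ℝ).map RatFunc.C *
          resolvent (Matrix.fromBlocks A₁₁ A₁₂ A₂₁ A₂₂) * (Matrix.fromRows R₁ R₂).map RatFunc.C) =
      R₁.map RatFunc.C + A₁₂.map RatFunc.C * resolvent A₂₂ * R₂.map RatFunc.C := by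
  have hR : (Matrix.fromRows R₁ R₂).map RatFunc.C =
      Matrix.fromRows (R₁.map RatFunc.C) (R₂.map RatFunc.C) := by
    ext i j
    rcases i with i | i <;> rfl
  rw [← Matrix.mul_assoc, X_sub_mul_resolvent_fromBlocks h, hR, Matrix.fromCols_mul_fromRows,
    Matrix.one_mul]

theorem X_sub_mul_network_tfm {W : TFM (Fin p) (Fin p)} {V : TFM (Fin p) (Fin m)}
    (h : Matrix.fromCols W V = (subsystem A₁₁ A₁₂ A₂₁ A₂₂ B₁ B₂).tfm) :
    ((RatFunc.X : RatFunc ℝ) • (1 : TFM (Fin p) (Fin p)) - W) *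
      (network A₁₁ A₁₂ A₂₁ A₂₂ B₁ B₂).tfm = V := by
  rw [network_tfm, X_sub_mul_resolvent_mul h, (eq_of_fromCols_eq_subsystem_tfm h).2]

theorem X_sub_mul_resolvent_eq_one {W : TFM (Fin p) (Fin p)} {V : TFM (Fin p) (Fin m)}
    (h : Matrix.fromCols W V = (subsystem A₁₁ A₁₂ A₂₁ A₂₂ B₁ B₂).tfm) :
    ((RatFunc.X : RatFunc ℝ) • (1 : TFM (Fin p) (Fin p)) - W) *
        ((Matrix.fromCols 1 0 : Matrix (Fin p) (Fin p ⊕ Fin q) ℝ).map RatFunc.C *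
          resolvent (Matrix.fromBlocks A₁₁ A₁₂ A₂₁ A₂₂) *
          (Matrix.fromRows 1 0 : Matrix (Fin p ⊕ Fin q) (Fin p) ℝ).map RatFunc.C) = 1 := by
  rw [X_sub_mul_resolvent_mul h]
  simp

theorem isUnit_det_X_sub_subsystem {W : TFM (Fin p) (Fin p)} {V : TFM (Fin p) (Fin m)}
    (h : Matrix.fromCols W V = (subsystem A₁₁ A₁₂ A₂₁ A₂₂ B₁ B₂).tfm) :
    IsUnit ((RatFunc.X : RatFunc ℝ) • (1 : TFM (Fin p) (Fin p)) - W).det :=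
  Matrix.isUnit_det_of_right_inverse (X_sub_mul_resolvent_eq_one h)

theorem network_tfm_eq {W : TFM (Fin p) (Fin p)} {V : TFM (Fin p) (Fin m)}
    (h : Matrix.fromCols W V = (subsystem A₁₁ A₁₂ A₂₁ A₂₂ B₁ B₂).tfm) :
    (network A₁₁ A₁₂ A₂₁ A₂₂ B₁ B₂).tfm =
      ((RatFunc.X : RatFunc ℝ) • (1 : TFM (Fin p) (Fin p)) - W)⁻¹ * V := by
  rw [← X_sub_mul_network_tfm h, nonsing_inv_mul_cancel_left _ _ (isUnit_det_X_sub_subsystem h)]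

theorem isSRTRPair_of_subsystem {W : TFM (Fin p) (Fin p)} {V : TFM (Fin p) (Fin m)}
    (h : Matrix.fromCols W V = (subsystem A₁₁ A₁₂ A₂₁ A₂₂ B₁ B₂).tfm) :
    IsSRTRPair (network A₁₁ A₁₂ A₂₁ A₂₂ B₁ B₂) W V := by
  have hprop := (subsystem A₁₁ A₁₂ A₂₁ A₂₂ B₁ B₂).isProper_tfm
  rw [← h] at hprop
  let S : StateSpace (Fin q) (Fin (p + m)) (Fin p) :=
    ⟨A₂₂, (Matrix.fromCols A₂₁ B₂).submatrix id finSumFinEquiv.symm, A₁₂,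
      (Matrix.fromCols A₁₁ B₁).submatrix id finSumFinEquiv.symm⟩
  have hS : S.tfm = hcat W V := by
    rw [hcat, h]
    rfl
  refine ⟨fun i j => hprop i (Sum.inl j), fun i j => hprop i (Sum.inr j),
    ⟨Module.finrank ℝ (ResponseModule S.tfm), ?_, ?_⟩, isUnit_det_X_sub_subsystem h,
    network_tfm_eq h⟩
  · rw [← hS]
    exact S.isProper_tfm.hasMcMillanDegree
  · simpa using S.finrank_responseModule_le

variable (A₁₁ A₁₂ A₂₁ A₂₂ B₁ B₂)

/-- The state matrix in the coordinates `(y, x + Ky)`. -/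
theorem fromBlocks_similarity (K : Matrix (Fin q) (Fin p) ℝ) :
    Matrix.fromBlocks (A₁₁ - A₁₂ * K) A₁₂ (K * A₁₁ - K * A₁₂ * K + A₂₁ - A₂₂ * K) (A₂₂ + K * A₁₂) *
        Matrix.fromBlocks 1 0 K 1 =
      Matrix.fromBlocks 1 0 K 1 * Matrix.fromBlocks A₁₁ A₁₂ A₂₁ A₂₂ := by
  rw [Matrix.fromBlocks_multiply, Matrix.fromBlocks_multiply]
  simp only [Matrix.mul_one, Matrix.one_mul, Matrix.mul_zero, Matrix.zero_mul, Matrix.add_mul,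
    Matrix.mul_assoc]
  congr 1 <;> abel

theorem network_tfm_similarity (K : Matrix (Fin q) (Fin p) ℝ) :
    (network (A₁₁ - A₁₂ * K) A₁₂ (K * A₁₁ - K * A₁₂ * K + A₂₁ - A₂₂ * K) (A₂₂ + K * A₁₂) B₁
      (K * B₁ + B₂)).tfm = (network A₁₁ A₁₂ A₂₁ A₂₂ B₁ B₂).tfm := by
  refine StateSpace.tfm_eq_of_similarity (fromBlocks_similarity A₁₁ A₁₂ A₂₁ A₂₂ K) ?_ ?_ rfl
  · simp [network, Matrix.fromBlocks_mul_fromRows]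
  · simp [network, Matrix.fromCols_mul_fromBlocks]

theorem isSRTRPair_srtrRealization (K : Matrix (Fin q) (Fin p) ℝ) {W : TFM (Fin p) (Fin p)}
    {V : TFM (Fin p) (Fin m)}
    (h : Matrix.fromCols W V = (srtrRealization A₁₁ A₁₂ A₂₁ A₂₂ B₁ B₂ K).tfm) :
    IsSRTRPair (network A₁₁ A₁₂ A₂₁ A₂₂ B₁ B₂) W V :=
  (isSRTRPair_of_subsystem h).of_tfm_eq (network_tfm_similarity A₁₁ A₁₂ A₂₁ A₂₂ B₁ B₂ K).symm

/-- `(λI - W)⁻¹` in terms of the state matrix of the network, when `W` belongs to `K`. -/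
theorem srtrRealization_inv (K : Matrix (Fin q) (Fin p) ℝ) {W : TFM (Fin p) (Fin p)}
    {V : TFM (Fin p) (Fin m)}
    (h : Matrix.fromCols W V = (srtrRealization A₁₁ A₁₂ A₂₁ A₂₂ B₁ B₂ K).tfm) :
    ((RatFunc.X : RatFunc ℝ) • (1 : TFM (Fin p) (Fin p)) - W)⁻¹ =
      (Matrix.fromCols 1 0 : Matrix (Fin p) (Fin p ⊕ Fin q) ℝ).map RatFunc.C *
        resolvent (Matrix.fromBlocks A₁₁ A₁₂ A₂₁ A₂₂) *
        (Matrix.fromRows 1 (-K) : Matrix (Fin p ⊕ Fin q) (Fin p) ℝ).map RatFunc.C := by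
  rw [Matrix.inv_eq_right_inv (X_sub_mul_resolvent_eq_one h)]
  have := StateSpace.tfm_eq_of_similarity (T := Matrix.fromBlocks 1 0 K 1)
    (S := ⟨Matrix.fromBlocks A₁₁ A₁₂ A₂₁ A₂₂, Matrix.fromRows 1 (-K), Matrix.fromCols 1 0,
      (0 : Matrix (Fin p) (Fin p) ℝ)⟩)
    (S' := ⟨Matrix.fromBlocks (A₁₁ - A₁₂ * K) A₁₂ (K * A₁₁ - K * A₁₂ * K + A₂₁ - A₂₂ * K)
      (A₂₂ + K * A₁₂), Matrix.fromRows 1 0, Matrix.fromCols 1 0, 0⟩)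
    (fromBlocks_similarity A₁₁ A₁₂ A₂₁ A₂₂ K) (by simp [Matrix.fromBlocks_mul_fromRows])
    (by simp [Matrix.fromCols_mul_fromBlocks]) rfl
  simpa only [StateSpace.tfm_eq_resolvent, Matrix.map_zero _ (map_zero RatFunc.C), zero_add]
    using this

theorem exists_srtrRealization_of_isMinimal
    (hmin : (network A₁₁ A₁₂ A₂₁ A₂₂ B₁ B₂).IsMinimal) {W : TFM (Fin p) (Fin p)}
    {V : TFM (Fin p) (Fin m)} (h : IsSRTRPair (network A₁₁ A₁₂ A₂₁ A₂₂ B₁ B₂) W V) :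
    ∃ K : Matrix (Fin q) (Fin p) ℝ,
      Matrix.fromCols W V = (srtrRealization A₁₁ A₁₂ A₂₁ A₂₂ B₁ B₂ K).tfm := by
  have hn := hmin.card_le
  obtain ⟨δ, hδ, hδq⟩ := h.degree_le
  obtain ⟨hfin, hfr⟩ := hδ.finiteDimensional_and_finrank_le
  have hprop : IsProper (hcat W V) := by
    intro i j
    change ((Matrix.fromCols W V) i (finSumFinEquiv.symm j)).num.natDegree ≤
      ((Matrix.fromCols W V) i (finSumFinEquiv.symm j)).denom.natDegree
    rcases finSumFinEquiv.symm j with j | j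
    · exact h.proper_W i j
    · exact h.proper_V i j
  obtain ⟨S, hS⟩ := hprop.exists_realization
  have hle := hfr.trans hδq
  generalize Module.finrank ℝ (ResponseModule (hcat W V)) = d at S hle
  have hsub : Matrix.fromCols W V =
      (subsystem (S.D.submatrix id (finSumFinEquiv ∘ Sum.inl)) S.C
        (S.B.submatrix id (finSumFinEquiv ∘ Sum.inl)) S.A
        (S.D.submatrix id (finSumFinEquiv ∘ Sum.inr))
        (S.B.submatrix id (finSumFinEquiv ∘ Sum.inr))).tfm := by
    ext i j
    have h1 := congrFun (congrFun hS i) (finSumFinEquiv j)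
    rw [hcat, Matrix.submatrix_apply, Equiv.symm_apply_apply] at h1
    rw [← id_def i, ← h1]
    rcases j with j | j <;> rfl
  generalize S.D.submatrix id (finSumFinEquiv ∘ Sum.inl) = A₁₁' at hsub
  generalize S.B.submatrix id (finSumFinEquiv ∘ Sum.inl) = A₂₁' at hsub
  generalize S.D.submatrix id (finSumFinEquiv ∘ Sum.inr) = B₁' at hsub
  generalize S.B.submatrix id (finSumFinEquiv ∘ Sum.inr) = B₂' at hsub
  generalize S.C = A₁₂' at hsub
  generalize S.A = A₂₂' at hsub
  have htfm : (network A₁₁' A₁₂' A₂₁' A₂₂' B₁' B₂').tfm = (network A₁₁ A₁₂ A₂₁ A₂₂ B₁ B₂).tfm := by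
    rw [h.tfm_eq, network_tfm_eq hsub]
  -- The glued network has order `p + d` and the same `G`, so minimality gives `q ≤ d`.
  obtain rfl : d = q := by
    have h1 := (network A₁₁' A₁₂' A₂₁' A₂₂' B₁' B₂').finrank_responseModule_le
    rw [htfm] at h1
    have h2 := hn.trans h1
    simp only [Fintype.card_sum, Fintype.card_fin] at h2
    omega
  obtain ⟨T, hT, hA, hB, hC⟩ := StateSpace.exists_similarity htfm hn
  rw [← Matrix.fromBlocks_toBlocks T] at hT hA hB hC
  generalize T.toBlocks₁₁ = T₁₁ at hT hA hB hC
  generalize T.toBlocks₁₂ = T₁₂ at hT hA hB hC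
  generalize T.toBlocks₂₁ = T₂₁ at hT hA hB hC
  generalize T.toBlocks₂₂ = T₂₂ at hT hA hB hC
  -- Comparing `[I 0]T` with `[I 0]` gives `T₁₁ = I` and `T₁₂ = 0`, so `T₂₂` inherits invertibility
  -- from `T`.
  simp only [network, Matrix.fromCols_mul_fromBlocks, Matrix.one_mul, Matrix.zero_mul, add_zero,
    Matrix.fromCols_inj.eq_iff] at hC
  obtain ⟨rfl, rfl⟩ := hC
  rw [Matrix.det_fromBlocks_zero₁₂, Matrix.det_one, one_mul] at hT
  simp only [network, Matrix.fromBlocks_multiply, Matrix.fromBlocks_inj, Matrix.mul_one,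
    Matrix.one_mul, Matrix.mul_zero, Matrix.zero_mul, zero_add, add_zero] at hA
  obtain ⟨h11, h12, h21, h22⟩ := hA
  simp only [network, Matrix.fromBlocks_mul_fromRows, Matrix.one_mul, Matrix.zero_mul,
    add_zero] at hB
  obtain ⟨hB1, hB2⟩ := Matrix.fromRows_inj hB
  have hK : T₂₂ * (T₂₂⁻¹ * T₂₁) = T₂₁ := Matrix.mul_nonsing_inv_cancel_left _ _ hT
  generalize T₂₂⁻¹ * T₂₁ = K at hK
  subst hK
  refine ⟨K, ?_⟩
  rw [hsub]
  -- Since `T = diag(I, T₂₂)·[I 0; K I]`, the change of coordinates by `K` leaves only the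
  -- similarity `T₂₂` between the two subsystems.
  refine StateSpace.tfm_eq_of_similarity (T := T₂₂) ?_ ?_ ?_ ?_
  · change A₂₂' * T₂₂ = T₂₂ * (A₂₂ + K * A₁₂)
    rw [h22, Matrix.mul_add, Matrix.mul_assoc, add_comm]
  · change T₂₂ * Matrix.fromCols (K * A₁₁ - K * A₁₂ * K + A₂₁ - A₂₂ * K) (K * B₁ + B₂) =
      Matrix.fromCols A₂₁' B₂'
    rw [Matrix.mul_fromCols, ← hB2]
    congr 1
    · rw [eq_sub_of_add_eq h21, ← Matrix.mul_assoc A₂₂', h22]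
      simp only [Matrix.mul_add, Matrix.mul_sub, Matrix.add_mul, Matrix.mul_assoc]
      abel
    · simp only [Matrix.mul_add, Matrix.mul_assoc]
  · exact h12
  · change Matrix.fromCols A₁₁' B₁' = Matrix.fromCols (A₁₁ - A₁₂ * K) B₁
    rw [← hB1, eq_sub_of_add_eq h11, ← Matrix.mul_assoc, h12]

end Network

/-! ### Observability -/

/-- The complex unobservable subspace is invariant under `A`. If it were nonzero, it would contain
an eigenvector killed by `C`, contrary to the rank condition at its eigenvalue. -/
theorem Observable.eq_zero_of_forall_mulVec_eq_zero {n p : Type*} [Fintype n] [DecidableEq n]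
    [Fintype p] {C : Matrix p n ℝ} {A : Matrix n n ℝ} (h : Observable C A) {x : n → ℝ}
    (hx : ∀ k : ℕ, C *ᵥ (A ^ k *ᵥ x) = 0) : x = 0 := by
  let A' : Matrix n n ℂ := A.map Complex.ofReal
  let C' : Matrix p n ℂ := C.map Complex.ofReal
  let N : Submodule ℂ (n → ℂ) := ⨅ k : ℕ, LinearMap.ker (Matrix.mulVecLin (C' * A' ^ k))
  have hN (y : n → ℂ) : y ∈ N ↔ ∀ k : ℕ, C' *ᵥ (A' ^ k *ᵥ y) = 0 := by
    simp [N, Submodule.mem_iInf, LinearMap.mem_ker]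
  have hker (z : ℂ) (y : n → ℂ) (hA : A' *ᵥ y = z • y) (hC : C' *ᵥ y = 0) : y = 0 := by
    have hr := h z
    rw [ControllableAt, ← Matrix.rank_transpose, Matrix.rank] at hr
    set M := (Matrix.fromCols (Aᵀ.map Complex.ofReal - z • (1 : Matrix n n ℂ))
      (Cᵀ.map Complex.ofReal))ᵀ with hM
    have hM' : M = Matrix.fromRows (A' - z • 1) C' := by
      rw [hM, Matrix.transpose_fromCols]
      simp [A', C', Matrix.transpose_map]
    have hinj : LinearMap.ker M.mulVecLin = ⊥ := by
      have h1 := M.mulVecLin.finrank_range_add_finrank_ker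
      rw [hr, Module.finrank_fintype_fun_eq_card] at h1
      exact Submodule.finrank_eq_zero.1 (by omega)
    have hy : y ∈ LinearMap.ker M.mulVecLin := by
      rw [LinearMap.mem_ker, Matrix.mulVecLin_apply, hM', Matrix.fromRows_mulVec, hC,
        Matrix.sub_mulVec, hA, Matrix.smul_mulVec, Matrix.one_mulVec, sub_self]
      ext i
      rcases i with i | i <;> rfl
    rwa [hinj, Submodule.mem_bot] at hy
  have hinv : ∀ y ∈ N, Matrix.mulVecLin A' y ∈ N := by
    intro y hy
    rw [hN] at hy ⊢
    intro k
    rw [Matrix.mulVecLin_apply, Matrix.mulVec_mulVec _ (A' ^ k), ← pow_succ]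
    exact hy (k + 1)
  have hbot : N = ⊥ := by
    by_contra hne
    have : Nontrivial N := Submodule.nontrivial_iff_ne_bot.2 hne
    obtain ⟨z, hz⟩ := Module.End.exists_eigenvalue ((Matrix.mulVecLin A').restrict hinv)
    obtain ⟨⟨y, hy⟩, hyz, hy0⟩ := hz.exists_hasEigenvector
    rw [Module.End.mem_eigenspace_iff] at hyz
    refine hy0 (Subtype.ext (hker z y (congrArg Subtype.val hyz) ?_))
    simpa using (hN y).1 hy 0
  have hmap {k : Type _} (M : Matrix k n ℝ) (y : n → ℝ) :
      M.map Complex.ofReal *ᵥ (Complex.ofReal ∘ y) = Complex.ofReal ∘ (M *ᵥ y) := by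
    ext1 i
    exact (RingHom.map_mulVec Complex.ofRealHom M y i).symm
  have hmem : Complex.ofReal ∘ x ∈ N := by
    rw [hN]
    intro k
    have hpow : A' ^ k = (A ^ k).map Complex.ofReal :=
      (Matrix.map_pow A Complex.ofRealHom k).symm
    ext1 i
    rw [hpow]
    have h1 := RingHom.map_mulVec Complex.ofRealHom C (A ^ k *ᵥ x) i
    rw [hx k] at h1
    rw [hmap]
    exact h1.symm.trans (by simp)
  rw [hbot, Submodule.mem_bot] at hmem
  ext1 i
  exact Complex.ofReal_eq_zero.1 (congrFun hmem i)

/-! ### Networks that are not minimal -/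

/-- A change of the state matrix that vanishes on the reachable states does not change the TFM. -/
theorem StateSpace.tfm_eq_of_reach {n m p : Type*} [Fintype n] [DecidableEq n] [Fintype m]
    [DecidableEq m] {S S' : StateSpace n m p} {w v : n → ℝ} (hw : ∀ u, w ⬝ᵥ S.reach u = 0)
    (hA : S'.A = S.A + Matrix.vecMulVec v w) (hB : S'.B = S.B) (hC : S'.C = S.C)
    (hD : S'.D = S.D) : S'.tfm = S.tfm := by
  let w' : Matrix Unit n ℝ := Matrix.replicateRow Unit w
  -- With `wᵀ` as output map, every reachable state has zero output at all times, whence `wᵀ(λI -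
  -- A)⁻¹B = 0`.
  let S₀ : StateSpace n m Unit := ⟨S.A, S.B, w', 0⟩
  have hreach (u : m → ℝ[X]) : S₀.reach u = S.reach u := by
    rw [reach_apply, reach_apply]
  have hout (u : m → ℝ[X]) (k : ℕ) :
      leadCoeffInfty (S₀.freeOutput (S.A ^ k *ᵥ S.reach u) ()) = 0 := by
    have h1 : S.A ^ k *ᵥ S.reach u = S.reach ((shift m)^[k] u) := by
      induction k with
      | zero => simp
      | succ k ih =>
        rw [Function.iterate_succ_apply', reach_shift, ← ih, Matrix.mulVec_mulVec, pow_succ']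
    rw [leadCoeffInfty_freeOutput, h1]
    exact hw _
  have hfree (u : m → ℝ[X]) : S₀.freeOutput (S.reach u) () = 0 := by
    refine eq_zero_of_valInfty_X_pow_mul_lt_one fun k => ?_
    have h1 : RatFunc.X ^ k * S₀.freeOutput (S.reach u) () =
        S₀.freeOutput (S.A ^ k *ᵥ S.reach u) () := by
      induction k with
      | zero => simp
      | succ k ih =>
        rw [pow_succ', mul_assoc, ih, X_mul_freeOutput, ← leadCoeffInfty_freeOutput, hout, map_zero,
          add_zero, Matrix.mulVec_mulVec, ← pow_succ']
    rw [h1]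
    exact S₀.valInfty_freeOutput _ _
  have hzero : w'.map RatFunc.C * resolvent S.A * S.B.map RatFunc.C = 0 := by
    ext i j
    have h1 := hfree (Pi.single j 1)
    rw [reach_single, map_one, Matrix.one_mulVec, freeOutput_apply] at h1
    rw [Matrix.mul_apply]
    exact h1
  have hvw : Matrix.vecMulVec v w = Matrix.replicateCol Unit v * w' := by
    rw [Matrix.vecMulVec_eq Unit]
  have hres : resolvent S.A * S.B.map RatFunc.C = resolvent S'.A * S'.B.map RatFunc.C := by
    apply eq_resolvent_mul
    rw [hA, hB, Matrix.map_add _ (map_add _), hvw, Matrix.map_mul, ← sub_sub, Matrix.sub_mul,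
      ← Matrix.mul_assoc, X_sub_mul_resolvent, Matrix.one_mul, Matrix.mul_assoc,
      ← Matrix.mul_assoc (w'.map RatFunc.C), hzero, Matrix.mul_zero, sub_zero]
  rw [S'.tfm_eq_resolvent, S.tfm_eq_resolvent, hC, hD, Matrix.mul_assoc, Matrix.mul_assoc, hres]

theorem exists_dotProduct_reach_eq_zero {n m p : Type*} [Fintype n] [DecidableEq n] [Fintype m]
    {S : StateSpace n m p} (hS : LinearMap.range S.reach ≠ ⊤) :
    ∃ w : n → ℝ, w ≠ 0 ∧ ∀ u, w ⬝ᵥ S.reach u = 0 := by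
  obtain ⟨f, hf, hle⟩ := Submodule.exists_le_ker_of_lt_top _ (lt_top_iff_ne_top.2 hS)
  have hfw (x : n → ℝ) : (fun i => f (Pi.single i 1)) ⬝ᵥ x = f x := by
    conv_rhs => rw [LinearMap.pi_apply_eq_sum_univ f x]
    simp only [dotProduct, smul_eq_mul]
    refine Finset.sum_congr rfl fun i _ => ?_
    rw [mul_comm]
    congr 2
    ext j
    simp [Pi.single_apply, eq_comm]
  refine ⟨fun i => f (Pi.single i 1), ?_, fun u => ?_⟩
  · rintro h
    refine hf (LinearMap.ext fun x => ?_)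
    rw [← hfw, h, zero_dotProduct, LinearMap.zero_apply]
  · rw [hfw]
    exact hle ⟨u, rfl⟩

/-- `ζ` is the future eigenvector: `w ⬝ᵥ ζ ≠ 0` lets a rank-one change `v wᵀ` prescribe the image of
`ζ`, and a nonzero `y`-part lets a matrix `K` generate its `x`-part. -/
theorem exists_dotProduct_ne_zero {p q : ℕ} (hp : 0 < p) {w : Fin p ⊕ Fin q → ℝ} (hw : w ≠ 0) :
    ∃ ζ : Fin p ⊕ Fin q → ℝ, w ⬝ᵥ ζ ≠ 0 ∧ ζ ∘ Sum.inl ≠ 0 := by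
  obtain ⟨i, hi⟩ := Function.ne_iff.1 hw
  let a : Fin p := ⟨0, hp⟩
  by_cases ha : w (Sum.inl a) = 0
  · have hia : i ≠ Sum.inl a := by rintro rfl; exact hi ha
    refine ⟨Pi.single i 1 + Pi.single (Sum.inl a) 1, ?_, fun h => ?_⟩
    · simpa [dotProduct_add, ha] using hi
    · have h1 := congrFun h a
      simp [hia.symm] at h1
  · refine ⟨Pi.single (Sum.inl a) 1, by simpa using ha, fun h => ?_⟩
    have h1 := congrFun h a
    simp at h1

theorem exists_mulVec_eq {p q : ℕ} {y : Fin p → ℝ} (hy : y ≠ 0) (x : Fin q → ℝ) :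
    ∃ K : Matrix (Fin q) (Fin p) ℝ, K *ᵥ y = x := by
  have h : y ⬝ᵥ y ≠ 0 := fun h => hy (dotProduct_self_eq_zero.1 h)
  refine ⟨Matrix.vecMulVec x ((y ⬝ᵥ y)⁻¹ • y), ?_⟩
  rw [Matrix.vecMulVec_mulVec, smul_dotProduct, smul_eq_mul, inv_mul_cancel₀ h]
  simp

theorem exists_eval_charpoly_ne_zero {n : Type*} [Fintype n] [DecidableEq n] (A : Matrix n n ℝ) :
    ∃ μ : ℝ, A.charpoly.eval μ ≠ 0 := by
  by_contra! h
  exact A.charpoly_monic.ne_zero (Polynomial.funext fun μ => by rw [h, eval_zero])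

theorem ratFunc_X_sub_C_ne_zero (μ : ℝ) : (RatFunc.X : RatFunc ℝ) - RatFunc.C μ ≠ 0 := by
  rw [← RatFunc.algebraMap_X, ← RatFunc.algebraMap_C, ← map_sub, Ne,
    FaithfulSMul.algebraMap_eq_zero_iff]
  exact X_sub_C_ne_zero μ

theorem resolvent_mulVec_eigenvector {n : Type*} [Fintype n] [DecidableEq n] {A : Matrix n n ℝ}
    {x : n → ℝ} {μ : ℝ} (hx : A *ᵥ x = μ • x) :
    resolvent A *ᵥ (fun i => RatFunc.C (x i)) =
      (RatFunc.X - RatFunc.C μ)⁻¹ • fun i => RatFunc.C (x i) := by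
  set x' : n → RatFunc ℝ := fun i => RatFunc.C (x i) with hx'
  have h0 := ratFunc_X_sub_C_ne_zero μ
  have h1 : ((RatFunc.X : RatFunc ℝ) • (1 : TFM n n) - A.map RatFunc.C) *ᵥ x' =
      (RatFunc.X - RatFunc.C μ) • x' := by
    rw [Matrix.sub_mulVec, ← map_mulVec, hx, Matrix.smul_mulVec, Matrix.one_mulVec, sub_smul]
    congr 1
    ext1 i
    simp [hx']
  have h2 : resolvent A *ᵥ ((RatFunc.X - RatFunc.C μ) • x') = x' := by
    rw [← h1, Matrix.mulVec_mulVec, resolvent_mul_X_sub, Matrix.one_mulVec]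
  rw [Matrix.mulVec_smul] at h2
  rw [eq_inv_smul_iff₀ h0, h2]

/-- A pole of `L(λI - A)⁻¹R` must be a root of the characteristic polynomial: multiply by it and by
`λ - μ`, so that both sides become polynomial, and evaluate at `μ`. -/
theorem eval_charpoly_eq_zero_of_mulVec_eq {n k l : Type*} [Fintype n] [DecidableEq n] [Fintype l]
    {A : Matrix n n ℝ} {L : Matrix k n ℝ} {R : Matrix n l ℝ} {y : l → ℝ} {x : k → ℝ} (hx : x ≠ 0)
    {μ : ℝ} (h : (L.map RatFunc.C * resolvent A * R.map RatFunc.C) *ᵥ (fun i => RatFunc.C (y i)) =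
      (RatFunc.X - RatFunc.C μ)⁻¹ • fun i => RatFunc.C (x i)) : A.charpoly.eval μ = 0 := by
  obtain ⟨i, hi⟩ := Function.ne_iff.1 hx
  have h0 := ratFunc_X_sub_C_ne_zero μ
  have h1 := congrArg (fun z => algebraMap ℝ[X] (RatFunc ℝ) A.charpoly • z) h
  simp only [← Matrix.smul_mulVec, ← Matrix.smul_mul] at h1
  rw [Matrix.smul_mul, ← Matrix.mul_smul, charpoly_smul_resolvent, map_ratFuncC, map_ratFuncC,
    ← Matrix.map_mul, ← Matrix.map_mul] at h1
  have hy : (fun i => RatFunc.C (y i)) =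
      algebraMap ℝ[X] (RatFunc ℝ) ∘ (fun i => Polynomial.C (y i)) := by
    ext1 i; simp
  have h2 := congrFun h1 i
  rw [hy] at h2
  have h3 := RingHom.map_mulVec (algebraMap ℝ[X] (RatFunc ℝ))
    (L.map Polynomial.C * A.charmatrix.adjugate * R.map Polynomial.C)
    (fun i => Polynomial.C (y i)) i
  rw [← h3, Pi.smul_apply, Pi.smul_apply, smul_eq_mul, smul_eq_mul, ← mul_assoc, mul_comm _ (_⁻¹),
    mul_assoc, eq_inv_mul_iff_mul_eq₀ h0, ← RatFunc.algebraMap_X, ← RatFunc.algebraMap_C,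
    ← RatFunc.algebraMap_C, ← map_sub, ← map_mul, ← map_mul] at h2
  have h4 := congrArg (Polynomial.eval μ) (IsFractionRing.injective ℝ[X] (RatFunc ℝ) h2)
  rw [eval_mul, eval_mul, eval_sub, eval_X, eval_C, eval_C, sub_self, zero_mul] at h4
  exact (mul_eq_zero.1 h4.symm).resolve_right hi

section Network

variable {p q m : ℕ} {A₁₁ : Matrix (Fin p) (Fin p) ℝ} {A₁₂ : Matrix (Fin p) (Fin q) ℝ}
  {A₂₁ : Matrix (Fin q) (Fin p) ℝ} {A₂₂ : Matrix (Fin q) (Fin q) ℝ}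
  {B₁ : Matrix (Fin p) (Fin m) ℝ} {B₂ : Matrix (Fin q) (Fin m) ℝ}

theorem exists_isSRTRPair_not_srtrRealization (hp : 0 < p)
    (hrange : LinearMap.range (network A₁₁ A₁₂ A₂₁ A₂₂ B₁ B₂).reach ≠ ⊤) :
    ∃ W V, IsSRTRPair (network A₁₁ A₁₂ A₂₁ A₂₂ B₁ B₂) W V ∧
      ∀ K, Matrix.fromCols W V ≠ (srtrRealization A₁₁ A₁₂ A₂₁ A₂₂ B₁ B₂ K).tfm := by
  obtain ⟨w, hw0, hw⟩ := exists_dotProduct_reach_eq_zero hrange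
  obtain ⟨ζ, hwζ, hζ⟩ := exists_dotProduct_ne_zero hp hw0
  obtain ⟨μ, hμ⟩ := exists_eval_charpoly_ne_zero (Matrix.fromBlocks A₁₁ A₁₂ A₂₁ A₂₂)
  -- This choice makes `[I; -K']` map the `y`-part of `ζ` to `ζ`.
  obtain ⟨K', hK'⟩ := exists_mulVec_eq hζ (-(ζ ∘ Sum.inr))
  let A := Matrix.fromBlocks A₁₁ A₁₂ A₂₁ A₂₂
  -- Solved from `(A + v wᵀ)ζ = μζ`.
  let v : Fin p ⊕ Fin q → ℝ := (w ⬝ᵥ ζ)⁻¹ • (μ • ζ - A *ᵥ ζ)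
  let A' := A + Matrix.vecMulVec v w
  have hA'ζ : A' *ᵥ ζ = μ • ζ := by
    have h1 : Matrix.vecMulVec v w *ᵥ ζ = μ • ζ - A *ᵥ ζ := by
      ext1 i
      rw [Matrix.vecMulVec_mulVec, op_smul_eq_smul, smul_inv_smul₀ hwζ]
    rw [Matrix.add_mulVec, h1, add_sub_cancel]
  have htfm : (network A₁₁ A₁₂ A₂₁ A₂₂ B₁ B₂).tfm =
      (network A'.toBlocks₁₁ A'.toBlocks₁₂ A'.toBlocks₂₁ A'.toBlocks₂₂ B₁ B₂).tfm :=
    (StateSpace.tfm_eq_of_reach (S' := network A'.toBlocks₁₁ A'.toBlocks₁₂ A'.toBlocks₂₁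
      A'.toBlocks₂₂ B₁ B₂) hw (Matrix.fromBlocks_toBlocks A') rfl rfl rfl).symm
  obtain ⟨W, V, hWV⟩ : ∃ W V, Matrix.fromCols W V = (srtrRealization A'.toBlocks₁₁ A'.toBlocks₁₂
      A'.toBlocks₂₁ A'.toBlocks₂₂ B₁ B₂ K').tfm := ⟨_, _, Matrix.fromCols_toCols _⟩
  refine ⟨W, V, (isSRTRPair_srtrRealization _ _ _ _ _ _ K' hWV).of_tfm_eq htfm, fun K hK => hμ ?_⟩
  -- `(λI - W)⁻¹` now has two expressions. Applied to the `y`-part of `ζ`, the one from `A'` gives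
  -- `(λ - μ)⁻¹` times that part, while the one from `A` has no pole at `μ`.
  have h1 := srtrRealization_inv _ _ _ _ _ _ K hK
  rw [srtrRealization_inv _ _ _ _ _ _ K' hWV, Matrix.fromBlocks_toBlocks] at h1
  refine eval_charpoly_eq_zero_of_mulVec_eq (L := Matrix.fromCols 1 0)
    (R := Matrix.fromRows 1 (-K)) (y := ζ ∘ Sum.inl) hζ ?_
  rw [← h1, ← Matrix.mulVec_mulVec, ← map_mulVec]
  have h2 : Matrix.fromRows (1 : Matrix (Fin p) (Fin p) ℝ) (-K') *ᵥ (ζ ∘ Sum.inl) = ζ := by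
    rw [Matrix.fromRows_mulVec, Matrix.one_mulVec, Matrix.neg_mulVec, hK', neg_neg]
    ext i
    rcases i with i | i <;> rfl
  have h3 : Matrix.fromCols (1 : Matrix (Fin p) (Fin p) ℝ) (0 : Matrix (Fin p) (Fin q) ℝ) *ᵥ ζ =
      ζ ∘ Sum.inl := by
    rw [Matrix.fromCols_mulVec, Matrix.one_mulVec, Matrix.zero_mulVec, add_zero]
  rw [h2, ← Matrix.mulVec_mulVec, resolvent_mulVec_eigenvector hA'ζ, Matrix.mulVec_smul,
    ← map_mulVec, h3]

theorem isMinimal_of_forall_exists_srtrRealization (hq : 0 < q)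
    (hobs : Observable (network A₁₁ A₁₂ A₂₁ A₂₂ B₁ B₂).C (network A₁₁ A₁₂ A₂₁ A₂₂ B₁ B₂).A)
    (h : ∀ W V, IsSRTRPair (network A₁₁ A₁₂ A₂₁ A₂₂ B₁ B₂) W V → ∃ K : Matrix (Fin q) (Fin p) ℝ,
      Matrix.fromCols W V = (srtrRealization A₁₁ A₁₂ A₂₁ A₂₂ B₁ B₂ K).tfm) :
    (network A₁₁ A₁₂ A₂₁ A₂₂ B₁ B₂).IsMinimal := by
  -- Without outputs every state is unobservable, and `q > 0` provides a nonzero one.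
  have hp : 0 < p := by
    rcases Nat.eq_zero_or_pos p with rfl | hp
    · have h1 := hobs.eq_zero_of_forall_mulVec_eq_zero (x := fun _ => 1)
        fun k => Subsingleton.elim _ _
      exact absurd (congrFun h1 (Sum.inr ⟨0, hq⟩)) one_ne_zero
    · exact hp
  refine StateSpace.isMinimal_of_range_reach
    (fun x hx => hobs.eq_zero_of_forall_mulVec_eq_zero hx) ?_
  by_contra hrange
  obtain ⟨W, V, hWV, hK⟩ := exists_isSRTRPair_not_srtrRealization hp hrange
  obtain ⟨K, hWK⟩ := h W V hWV
  exact hK K hWK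

end Network

end SRTR

end

theorem theorem3p1 (p q m : ℕ) (hq : 0 < q)
    (A₁₁ : Matrix (Fin p) (Fin p) ℝ) (A₁₂ : Matrix (Fin p) (Fin q) ℝ)
    (A₂₁ : Matrix (Fin q) (Fin p) ℝ) (A₂₂ : Matrix (Fin q) (Fin q) ℝ)
    (B₁ : Matrix (Fin p) (Fin m) ℝ) (B₂ : Matrix (Fin q) (Fin m) ℝ)
    (hobs : SRTR.Observable (SRTR.network A₁₁ A₁₂ A₂₁ A₂₂ B₁ B₂).C
      (SRTR.network A₁₁ A₁₂ A₂₁ A₂₂ B₁ B₂).A) :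
    (∀ (K : Matrix (Fin q) (Fin p) ℝ) (W : SRTR.TFM (Fin p) (Fin p))
        (V : SRTR.TFM (Fin p) (Fin m)),
        Matrix.fromCols W V = (SRTR.srtrRealization A₁₁ A₁₂ A₂₁ A₂₂ B₁ B₂ K).tfm →
        SRTR.IsSRTRPair (SRTR.network A₁₁ A₁₂ A₂₁ A₂₂ B₁ B₂) W V) ∧
    ((∀ (W : SRTR.TFM (Fin p) (Fin p)) (V : SRTR.TFM (Fin p) (Fin m)),
        SRTR.IsSRTRPair (SRTR.network A₁₁ A₁₂ A₂₁ A₂₂ B₁ B₂) W V →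
        ∃ K : Matrix (Fin q) (Fin p) ℝ,
          Matrix.fromCols W V = (SRTR.srtrRealization A₁₁ A₁₂ A₂₁ A₂₂ B₁ B₂ K).tfm) ↔
      (SRTR.network A₁₁ A₁₂ A₂₁ A₂₂ B₁ B₂).IsMinimal) :=
  ⟨fun K _ _ h => SRTR.isSRTRPair_srtrRealization A₁₁ A₁₂ A₂₁ A₂₂ B₁ B₂ K h,
    fun h => SRTR.isMinimal_of_forall_exists_srtrRealization hq hobs h,
    fun hmin _ _ h =>
      SRTR.exists_srtrRealization_of_isMinimal A₁₁ A₁₂ A₂₁ A₂₂ B₁ B₂ hmin h⟩
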